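/- **Theorem 1.3.** Let $\mathcal U=\{\mathcal U_n\}_{n\in\mathbb N}$ be any quantum oracle, i.e. a unitary $\mathcal U_n$ on $n$ qubits for each $n$. All quantum circuits below are over the gates $H$, $T$, CNOT together with (possibly controlled) queries to $\mathcal U_n$ and $\mathcal U_n^\dagger$, a query to $\mathcal U_n$ costing about $n$; the unrelativized world is the case where every $\mathcal U_n$ is the identity. A polynomial-time quantum algorithm is one whose circuit, on a given classical input, is written down by a polynomial-time Turing machine. Suppose that a *hyperefficient shadow tomography procedure* exists for observables $|\psi_i\rangle\langle\psi_i|$ with state-preparation access: a quantum algorithm that, given integers $n,m\ge 0$ and $e\ge 1$ (where $M=2^m$ and $\varepsilon=1/e$), a description of a circuit $P$ that on each input $i\in\{0,1\}^m$ outputs an $n$-qubit pure state $|\psi_i\rangle$ (other wires may be left in any state), and copies of an $n$-qubit mixed state $\rho$, runs in time polynomial in $n$, $\log M = m$, $1/\varepsilon$ and $|P|$, and for every $\rho$ outputs with probability at least $2/3$ the description of a quantum circuit $C$ such that, for each $i$, the output of $C(i)$ satisfies $|C(i)-\mathrm{Tr}(|\psi_i\rangle\langle\psi_i|\rho)|\le\varepsilon$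 with probability at least $2/3$. Let $\{|\varphi_k\rangle\}_{k\in\{0,1\}^\kappa}$ ($\kappa\in\mathbb N$) be a pseudorandom state ensemble relative to $\mathcal U$, of $n(\kappa)$ qubits: a uniform polynomial-time quantum algorithm generates $|\varphi_k\rangle$ from $k$, and every non-uniform polynomial-size family of quantum adversaries, given any polynomial number of copies, has negligible advantage in distinguishing a uniformly random $|\varphi_k\rangle$ from a Haar-random $n(\kappa)$-qubit state. Assume that $n(\kappa)$ is large enough that $2^\kappa e^{-2^{n(\kappa)}/3}$ is negligible in $\kappa$. Then the ensemble can be broken by polynomial-time quantum adversaries with oracle access to $\mathsf{QCMA}^{\mathcal U}$: there are a promise problem $(Q_{\mathrm{yes}},Q_{\mathrm{no}})\in\mathsf{QCMA}^{\mathcal U}$, a polynomially bounded $T(\kappa)$, a (non-uniform) polynomial-size family of quantum oracle circuits $\mathcal A_\kappa$, and a constant $c>0$ such that for every language $L$ with $Q_{\mathrm{yes}}\subseteq L$ and $Q_{\mathrm{no}}\cap L=\emptyset$, and for all sufficiently large $\kappa$, $$\left|\Pr_{k\leftarrow\{0,1\}^\kappa}\left[\mathcal A_\kappa^{\mathcal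 U,L}\left(|\varphi_k\rangle^{\otimes T(\kappa)}\right)=1\right]-\Pr_{|\psi\rangle\leftarrow\sigma_{2^{n(\kappa)}}}\left[\mathcal A_\kappa^{\mathcal U,L}\left(|\psi\rangle^{\otimes T(\kappa)}\right)=1\right]\right|\ge c.$$ Here $\sigma_N$ is the Haar measure on pure states of dimension $N$. -/

import Mathlib

open MeasureTheory Filter
open scoped ComplexConjugate ComplexOrder

/-! ### Qubits, states and elementary matrices -/

/-- Bit strings of length `n`; they index the computational basis of `n` qubits. -/
abbrev Bits (n : ℕ) : Type := Fin n → Bool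

/-- Operators on `n` qubits, as matrices in the computational basis. -/
abbrev QMat (n : ℕ) : Type := Matrix (Bits n) (Bits n) ℂ

/-- Pure states of `n` qubits: unit vectors of `ℂ^(2^n)`. -/
abbrev PureState (n : ℕ) : Type := Metric.sphere (0 : EuclideanSpace ℂ (Bits n)) 1

/-- The projector `|ψ⟩⟨ψ|`. -/
def PureState.proj {n : ℕ} (ψ : PureState n) : QMat n :=
  fun x y => ψ.1 x * conj (ψ.1 y)

/-- The Haar measure on pure states: the normalized surface measure of the unit sphere. -/
noncomputable def haarState (n : ℕ) : Measure (PureState n) :=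
  ((volume : Measure (EuclideanSpace ℂ (Bits n))).toSphere Set.univ)⁻¹ •
    (volume : Measure (EuclideanSpace ℂ (Bits n))).toSphere

/-- Mixed states of `n` qubits. -/
def IsMixedState {n : ℕ} (ρ : QMat n) : Prop := ρ.PosSemidef ∧ ρ.trace = 1

/-- The basis state `|x⟩⟨x|`. -/
def ketbra {n : ℕ} (x : Bits n) : QMat n := Matrix.single x x 1

/-- `ρ^{⊗T}`; the `j`-th qubit of the `t`-th copy is qubit number `t * n + j`. -/
def tensorPower (T : ℕ) {n : ℕ} (ρ : QMat n) : QMat (T * n) :=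
  fun x y => ∏ t : Fin T,
    ρ (fun j => x (finProdFinEquiv (t, j))) (fun j => y (finProdFinEquiv (t, j)))

/-- The probability that measuring the state `ρ` in the computational basis gives a string
in `S`. -/
noncomputable def measureProb {n : ℕ} (ρ : QMat n) (S : Set (Bits n)) : ℝ :=
  open Classical in ∑ y : Bits n, if y ∈ S then (ρ y y).re else 0

/-- The outcomes whose first bit exists and equals `1`. -/
def firstBitOne (n : ℕ) : Set (Bits n) := {y | ∃ h : 0 < n, y ⟨0, h⟩ = true}

/-- The Hadamard gate. -/
noncomputable def hadamardMatrix : QMat 1 :=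
  fun x y => if x 0 && y 0 then -((Real.sqrt 2 : ℂ))⁻¹ else ((Real.sqrt 2 : ℂ))⁻¹

/-- The `T` gate `diag(1, e^{iπ/4})`. -/
noncomputable def tMatrix : QMat 1 :=
  Matrix.diagonal fun x => if x 0 then Complex.exp (Complex.I * Real.pi / 4) else 1

/-- The CNOT gate `|a, b⟩ ↦ |a, b ⊕ a⟩`. -/
def cnotMatrix : QMat 2 :=
  fun x y => if x = ![y 0, xor (y 1) (y 0)] then 1 else 0

/-- The controlled version of `M`; qubit `0` is the control. -/
def controlledMatrix {m : ℕ} (M : QMat m) : QMat (m + 1) :=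
  fun x y => if x 0 = y 0 then
    (if x 0 then M (Fin.tail x) (Fin.tail y) else (1 : QMat m) (Fin.tail x) (Fin.tail y))
  else 0

/-- The query unitary `|b⟩|z⟩ ↦ |b ⊕ L(z)⟩|z⟩` of a language `L`; qubit `0` is the target. -/
noncomputable def languageMatrix (L : Set (List Bool)) (m : ℕ) : QMat (m + 1) :=
  open Classical in
  fun x y => if x = Fin.cons (xor (y 0) (decide (List.ofFn (Fin.tail y) ∈ L))) (Fin.tail y)
    then 1 else 0

/-- `M` applied to the distinct wires `ws 0, ws 1, …` of an `N`-qubit register. -/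
def embedMatrix {m : ℕ} (N : ℕ) (ws : Fin m → Fin N) (M : QMat m) : QMat N :=
  fun x y => if ∀ i, (∀ j, ws j ≠ i) → x i = y i then M (x ∘ ws) (y ∘ ws) else 0

/-- `M` applied to the listed wires of an `N`-qubit register. A malformed instruction (a wire
that does not exist, or that is listed twice) does nothing. -/
def applyOn (N : ℕ) (ws : List ℕ) (M : QMat ws.length) : QMat N :=
  if h : ws.Nodup ∧ ∀ a ∈ ws, a < N then
    embedMatrix N (fun j => ⟨ws.get j, h.2 _ (List.get_mem ws j)⟩) M
  else 1

/-! ### Quantum circuits with oracle gates -/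

/-- A quantum oracle: a unitary transformation `U n` on `n` qubits for every `n`. -/
abbrev QuantumOracle : Type := ∀ n : ℕ, Matrix.unitaryGroup (Bits n) ℂ

/-- The unitary of a query to `U`, or to `U†` if `adj` is set. -/
def QuantumOracle.queryMatrix (U : QuantumOracle) (adj : Bool) (m : ℕ) : QMat m :=
  if adj then (U m : QMat m).conjTranspose else (U m : QMat m)

/-- Gates: the universal set `{H, T, CNOT}`, and queries to `U_m` or `U_m†` on a list of `m`
wires, without or with a control wire `c`. -/
inductive Gate : Type
  | hadamard (a : ℕ)
  | tGate (a : ℕ)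
  | cnot (a b : ℕ)
  | query (adj : Bool) (ws : List ℕ)
  | cquery (adj : Bool) (c : ℕ) (ws : List ℕ)

/-- The operator of a gate on an `N`-qubit register. -/
noncomputable def Gate.matrix (U : QuantumOracle) (N : ℕ) : Gate → QMat N
  | .hadamard a => applyOn N [a] hadamardMatrix
  | .tGate a => applyOn N [a] tMatrix
  | .cnot a b => applyOn N [a, b] cnotMatrix
  | .query adj ws => applyOn N ws (U.queryMatrix adj ws.length)
  | .cquery adj c ws => applyOn N (c :: ws) (controlledMatrix (U.queryMatrix adj ws.length))

/-- The cost of a gate; a query to `U_m` costs at least `m`. -/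
def Gate.cost : Gate → ℕ
  | .hadamard _ => 1
  | .tGate _ => 1
  | .cnot _ _ => 1
  | .query _ ws => ws.length + 1
  | .cquery _ _ ws => ws.length + 2

/-- Gates of an algorithm that has, besides `U`, oracle access to a language. -/
inductive LGate : Type
  | base (g : Gate)
  | lang (target : ℕ) (ws : List ℕ)

/-- The operator of such a gate for the language `L`. -/
noncomputable def LGate.matrix (U : QuantumOracle) (L : Set (List Bool)) (N : ℕ) :
    LGate → QMat N
  | .base g => g.matrix U N
  | .lang t ws => applyOn N (t :: ws) (languageMatrix L ws.length)

/-- The cost of such a gate. -/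
def LGate.cost : LGate → ℕ
  | .base g => g.cost
  | .lang _ ws => ws.length + 2

/-- Circuits over a gate type, with `d` input qubits and `o` output qubits. -/
structure Circuit (γ : Type) (d o : ℕ) : Type where
  /-- The requested number of wires (enlarged, if necessary, to hold the input and the output). -/
  width : ℕ
  /-- The gates, the first one being applied first. -/
  gates : List γ

namespace Circuit

variable {γ : Type} {d o : ℕ}

/-- The number of wires. -/
def wires (C : Circuit γ d o) : ℕ := max C.width (max d o)

/-- The number of wires plus the total cost of the gates. -/
def size (cost : γ → ℕ) (C : Circuit γ d o) : ℕ := C.wires + (C.gates.map cost).sum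

/-- The operator of the circuit on all its wires. -/
noncomputable def operator (sem : ∀ N : ℕ, γ → QMat N) (C : Circuit γ d o) : QMat C.wires :=
  C.gates.foldl (fun M g => sem C.wires g * M) 1

/-- `ρ ⊗ |0…0⟩⟨0…0|`: the input is on the first `d` wires, all other wires start in `|0⟩`. -/
def initialState (C : Circuit γ d o) (ρ : QMat d) : QMat C.wires :=
  have h : d ≤ C.wires := le_trans (le_max_left _ _) (le_max_right _ _)
  fun x y => if ∀ i : Fin C.wires, d ≤ i.1 → x i = false ∧ y i = false then
    ρ (x ∘ Fin.castLE h) (y ∘ Fin.castLE h) else 0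

/-- The partial trace over all but the first `o` wires, which carry the output. -/
def traceOut (C : Circuit γ d o) (τ : QMat C.wires) : QMat o :=
  have h : o ≤ C.wires := le_trans (le_max_right _ _) (le_max_right _ _)
  fun a b => ∑ x : Bits C.wires, ∑ y : Bits C.wires,
    if x ∘ Fin.castLE h = a ∧ y ∘ Fin.castLE h = b ∧
      ∀ i : Fin C.wires, o ≤ i.1 → x i = y i then τ x y else 0

/-- The output state of the circuit on the input state `ρ`. Measurements of the output are made
on this state; intermediate measurements are deferred. -/
noncomputable def run (sem : ∀ N : ℕ, γ → QMat N) (C : Circuit γ d o) (ρ : QMat d) : QMat o :=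
  C.traceOut (C.operator sem * C.initialState ρ * (C.operator sem).conjTranspose)

end Circuit

/-! ### Descriptions of circuits by bit strings -/

/-- A circuit together with its numbers of input and output qubits. -/
abbrev SomeCircuit : Type := (d : ℕ) × (o : ℕ) × Circuit Gate d o

/-- The self-delimiting unary code `1^n 0` of a number. -/
def unaryCode (n : ℕ) : List Bool := List.replicate n true ++ [false]

/-- Reads a sequence of unary codes; an incomplete last code is ignored. The first argument
counts the `1`s read since the last `0`. -/
def readUnary : ℕ → List Bool → List ℕ
  | _, [] => []
  | a, true :: l => readUnary (a + 1) l
  | a, false :: l => a :: readUnary 0 l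

/-- The code of a gate: an operation code, followed by its wires (for a query preceded by their
number). -/
def Gate.code : Gate → List ℕ
  | .hadamard a => [0, a]
  | .tGate a => [1, a]
  | .cnot a b => [2, a, b]
  | .query false ws => 3 :: ws.length :: ws
  | .query true ws => 4 :: ws.length :: ws
  | .cquery false c ws => 5 :: c :: ws.length :: ws
  | .cquery true c ws => 6 :: c :: ws.length :: ws

/-- Reads a sequence of gate codes, up to the first malformed one. -/
def readGates : List ℕ → List Gate
  | 0 :: a :: l => .hadamard a :: readGates l
  | 1 :: a :: l => .tGate a :: readGates l
  | 2 :: a :: b :: l => .cnot a b :: readGates l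
  | 3 :: k :: l => .query false (l.take k) :: readGates (l.drop k)
  | 4 :: k :: l => .query true (l.take k) :: readGates (l.drop k)
  | 5 :: c :: k :: l => .cquery false c (l.take k) :: readGates (l.drop k)
  | 6 :: c :: k :: l => .cquery true c (l.take k) :: readGates (l.drop k)
  | _ => []
  termination_by l => l.length
  decreasing_by all_goals (simp_wf; try omega)

/-- The standard description of a circuit. -/
def encodeCircuit (C : SomeCircuit) : List Bool :=
  (C.1 :: C.2.1 :: C.2.2.width :: C.2.2.gates.flatMap Gate.code).flatMap unaryCode

/-- The circuit described by a bit string. -/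
def decodeCircuit (s : List Bool) : SomeCircuit :=
  match readUnary 0 s with
  | d :: o :: w :: l => ⟨d, o, ⟨w, readGates l⟩⟩
  | _ => ⟨0, 0, ⟨0, []⟩⟩

theorem readUnary_replicate (n a : ℕ) (l : List Bool) :
    readUnary a (List.replicate n true ++ false :: l) = (a + n) :: readUnary 0 l := by
  induction n generalizing a with
  | zero => simp [readUnary]
  | succ n ih => simp [List.replicate_succ, readUnary, ih]; omega

theorem readUnary_flatMap (l : List ℕ) : readUnary 0 (l.flatMap unaryCode) = l := by
  induction l with
  | nil => simp [readUnary]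
  | cons n l ih => simp [unaryCode, readUnary_replicate, ih]

theorem readGates_flatMap (l : List Gate) : readGates (l.flatMap Gate.code) = l := by
  induction l with
  | nil => simp [readGates]
  | cons g l ih =>
    rcases g with a | a | ⟨a, b⟩ | ⟨_ | _, ws⟩ | ⟨_ | _, c, ws⟩ <;>
      simp [Gate.code, readGates, ih]

/-- Every circuit is described by its standard description. -/
theorem decode_encode (C : SomeCircuit) : decodeCircuit (encodeCircuit C) = C := by
  obtain ⟨d, o, w, l⟩ := C
  simp only [decodeCircuit, encodeCircuit, readUnary_flatMap, readGates_flatMap]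

/-! ### Polynomial time, QCMA -/

/-- `f` is computed by a deterministic multi-stack Turing machine in polynomial time. -/
def PolyTime (f : List Bool → List Bool) : Prop :=
  Nonempty (Turing.TM2ComputableInPolyTime (id : List Bool → List Bool)
    (id : List Bool → List Bool) f)

/-- `g` is bounded by a polynomial. -/
def PolyBounded (g : ℕ → ℕ) : Prop := ∃ p : Polynomial ℕ, ∀ κ, g κ ≤ p.eval κ

/-- `g` is negligible: smaller than every inverse polynomial. -/
def Negligible (g : ℕ → ℝ) : Prop :=
  Asymptotics.SuperpolynomialDecay atTop (fun κ : ℕ => (κ : ℝ)) g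

/-- A promise problem. -/
structure PromiseProblem : Type where
  yes : Set (List Bool)
  no : Set (List Bool)

/-- The probability that the circuit, run on the classical input `w`, accepts, that is, has first
output bit `1`. -/
noncomputable def acceptProb (U : QuantumOracle) {d o : ℕ} (C : Circuit Gate d o) (w : Bits d) :
    ℝ :=
  measureProb (C.run (Gate.matrix U) (ketbra w)) (firstBitOne o)

/-- `QCMA` relative to `U`. The verifier is a polynomial-time quantum algorithm: a Turing machine
computes from `x`, in polynomial time, a description of the quantum circuit that is then run on
the classical witness. -/
def InQCMA (U : QuantumOracle) (Q : PromiseProblem) : Prop :=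
  ∃ f : List Bool → List Bool, PolyTime f ∧
    (∃ p : Polynomial ℕ, ∀ x, (decodeCircuit (f x)).1 ≤ p.eval x.length) ∧
    (∀ x ∈ Q.yes, ∃ w : Bits (decodeCircuit (f x)).1,
      2 / 3 ≤ acceptProb U (decodeCircuit (f x)).2.2 w) ∧
    (∀ x ∈ Q.no, ∀ w : Bits (decodeCircuit (f x)).1,
      acceptProb U (decodeCircuit (f x)).2.2 w ≤ 1 / 3)

/-! ### Hyperefficient shadow tomography -/

/-- The circuit `P` gives state preparation access to the states `ψ i`: on input `i`, it outputs
`|ψ i⟩` (further wires may end up in any state). -/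
def Prepares (U : QuantumOracle) {m n : ℕ} (P : Circuit Gate m n) (ψ : Bits m → PureState n) :
    Prop :=
  ∀ i, P.run (Gate.matrix U) (ketbra i) = (ψ i).proj

/-- The number `0.y₀y₁y₂…` in binary. -/
noncomputable def binaryFraction {o : ℕ} (y : Bits o) : ℝ :=
  ∑ j : Fin o, if y j then (1 / 2 : ℝ) ^ (j.1 + 1) else 0

/-- The circuit `C` estimates `Tr(|ψ i⟩⟨ψ i| ρ)` to within `ε`: for each `i` the output of `C` on
input `i` does so with probability at least `2/3`. -/
def Estimates (U : QuantumOracle) {m n o : ℕ} (C : Circuit Gate m o) (ψ : Bits m → PureState n)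
    (ρ : QMat n) (ε : ℝ) : Prop :=
  ∀ i, 2 / 3 ≤ measureProb (C.run (Gate.matrix U) (ketbra i))
    {y | |binaryFraction y - ((ψ i).proj * ρ).trace.re| ≤ ε}

/-- The bit string `y` describes a circuit that estimates all the `Tr(|ψ i⟩⟨ψ i| ρ)` to
within `ε`. -/
def DescribesEstimator (U : QuantumOracle) {m n : ℕ} (ψ : Bits m → PureState n) (ρ : QMat n)
    (ε : ℝ) (y : List Bool) : Prop :=
  ∃ (o : ℕ) (C : Circuit Gate m o), decodeCircuit y = ⟨m, o, C⟩ ∧ Estimates U C ψ ρ ε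

/-- There is a hyperefficient shadow tomography procedure, relative to `U`, for observables
`|ψ i⟩⟨ψ i|` with state preparation access to the `|ψ i⟩`, `i ∈ {0,1}^m`. The procedure is a
polynomial-time quantum algorithm: from `n`, `m = log M`, `1/ε = e` (all in unary) and a
description `p` of the preparing circuit, a Turing machine computes in polynomial time a quantum
circuit `V`; this is run on copies of `ρ`, and, with probability at least `2/3`, the measured
output describes a circuit that estimates all expectation values to within `ε`. -/
def HyperefficientShadowTomography (U : QuantumOracle) : Prop :=
  ∃ f : List Bool → List Bool, PolyTime f ∧
    ∀ (n m e : ℕ) (p : List Bool) (P : Circuit Gate m n) (ψ : Bits m → PureState n),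
      1 ≤ e → decodeCircuit p = ⟨m, n, P⟩ → Prepares U P ψ →
      ∃ (T s : ℕ) (V : Circuit Gate (T * n) s),
        decodeCircuit (f (unaryCode n ++ unaryCode m ++ unaryCode e ++ p)) = ⟨T * n, s, V⟩ ∧
        ∀ ρ : QMat n, IsMixedState ρ →
          2 / 3 ≤ measureProb (V.run (Gate.matrix U) (tensorPower T ρ))
            {y | DescribesEstimator U ψ ρ (1 / (e : ℝ)) (List.ofFn y)}

/-! ### Pseudorandom states -/

/-- For every security parameter `κ`, a family of pure states of `n κ` qubits, keyed by
`{0,1}^κ`. -/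
structure KeyedStates : Type where
  n : ℕ → ℕ
  state : ∀ κ : ℕ, Bits κ → PureState (n κ)

/-- The advantage of the adversary circuit `A`, run on `T` copies, in distinguishing a random
state of the family with security parameter `κ` from a Haar-random state. -/
noncomputable def KeyedStates.advantage (E : KeyedStates) {γ : Type}
    (sem : ∀ N : ℕ, γ → QMat N) (κ T : ℕ) (A : Circuit γ (T * E.n κ) 1) : ℝ :=
  |(2 ^ κ : ℝ)⁻¹ * (∑ k : Bits κ,
      measureProb (A.run sem (tensorPower T (E.state κ k).proj)) (firstBitOne 1))
    - ∫ ψ : PureState (E.n κ),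
      measureProb (A.run sem (tensorPower T ψ.proj)) (firstBitOne 1) ∂(haarState (E.n κ))|

/-- The states are generated from the key by a (uniform) polynomial-time quantum algorithm with
access to `U`. -/
def KeyedStates.EfficientlyGenerated (E : KeyedStates) (U : QuantumOracle) : Prop :=
  ∃ f : List Bool → List Bool, PolyTime f ∧ ∀ κ : ℕ, ∃ G : Circuit Gate κ (E.n κ),
    decodeCircuit (f (List.replicate κ true)) = ⟨κ, E.n κ, G⟩ ∧ Prepares U G (E.state κ)

/-- Pseudorandom states relative to `U`: efficiently generated, and every polynomial-size
adversary with access to `U` and polynomially many copies has negligible advantage. (Adversaries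
are non-uniform with classical advice: a circuit for every `κ`.) -/
def KeyedStates.IsPseudorandom (E : KeyedStates) (U : QuantumOracle) : Prop :=
  E.EfficientlyGenerated U ∧
  ∀ (T : ℕ → ℕ) (A : ∀ κ : ℕ, Circuit Gate (T κ * E.n κ) 1), PolyBounded T →
    PolyBounded (fun κ => (A κ).size Gate.cost) →
    Negligible (fun κ => E.advantage (Gate.matrix U) κ (T κ) (A κ))

/-- The family is broken by polynomial-time quantum adversaries with oracle access to `U` and to
`QCMA` relative to `U`: for a promise problem in this class, a polynomial-size adversary with
polynomially many copies has, for all large `κ`, at least some constant advantage, however the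
oracle answers outside the promise. -/
def KeyedStates.BrokenWithQCMA (E : KeyedStates) (U : QuantumOracle) : Prop :=
  ∃ Q : PromiseProblem, InQCMA U Q ∧
  ∃ (T : ℕ → ℕ) (A : ∀ κ : ℕ, Circuit LGate (T κ * E.n κ) 1), PolyBounded T ∧
    PolyBounded (fun κ => (A κ).size LGate.cost) ∧
    ∃ c : ℝ, 0 < c ∧ ∀ L : Set (List Bool), Q.yes ⊆ L → Disjoint L Q.no →
      ∀ᶠ κ in atTop, c ≤ E.advantage (LGate.matrix U L) κ (T κ) (A κ)

/-! ### Concentration of measure for Haar-random states -/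

/-! The adversary runs the tomography procedure for the observables
$|\varphi_k\rangle\langle\varphi_k|$ with error 1/100 on its copies of the unknown state. The
measured output describes a circuit that estimates every overlap with a key state, and the adversary
submits this description to the oracle, asking whether some input makes the first output bit equal
to 1. Asking for such a key is a QCMA question (`witnessProblem`).

The first bit of a binary fraction compares it with 1/2. On $|\varphi_k\rangle$ the key $k$ is a
witness, since the overlap is 1 (`DescribesEstimator.mem_yes`). If all overlaps are below 12/25,
there is no witness (`DescribesEstimator.mem_no`). So whenever tomography succeeds, the query
satisfies the promise; every answer outside the promise falls into the failure probability of at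
most 1/3. By a union bound over the keys (`haarState_overlap_le`), a Haar state has a larger overlap
with probability at most $8\cdot 2^\kappa e^{-2^n/3}$. The acceptance probabilities are therefore at
least 2/3 and at most 1/3 plus a negligible term.

Two points need work. The adversary must be an actual circuit whose acceptance probability is that
of the tomography output lying in $L$ (`Circuit.measureProb_thenAsk`). Its size must be polynomial:
a polynomial-time machine has polynomially long output, and the unary code makes a described circuit
no larger than its description (`decodeCircuit_le`). -/

theorem toSphere_univ_ne_zero (n : ℕ) :
    (volume : Measure (EuclideanSpace ℂ (Bits n))).toSphere Set.univ ≠ 0 := by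
  rw [Ne, Measure.measure_univ_eq_zero]
  exact Measure.toSphere_ne_zero _

/-- The cone over a spherical cap of height `a`, truncated by the unit ball, lies in the ball of
radius `√(1 - a²)` around `a • v`. -/
theorem dist_smul_sq_le_of_mem_cap {V : Type*} [NormedAddCommGroup V] [InnerProductSpace ℝ V]
    {v x : V} {a r : ℝ} (hv : ‖v‖ = 1) (hx : ‖x‖ = 1) (ha : 0 ≤ a) (ha2 : a ^ 2 ≤ 1 / 2)
    (hr : 0 ≤ r) (hr1 : r ≤ 1) (h : a ≤ inner ℝ v x) :
    dist (r • x) (a • v) ^ 2 ≤ 1 - a ^ 2 := by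
  rw [dist_eq_norm, norm_sub_sq_real, norm_smul, norm_smul, hv, hx, real_inner_smul_left,
    real_inner_smul_right, real_inner_comm, Real.norm_of_nonneg hr, Real.norm_of_nonneg ha]
  have h1 : r * (a * a) ≤ r * (a * inner ℝ v x) := by gcongr
  nlinarith [mul_nonneg hr (sub_nonneg.2 hr1)]

/-- The surface measure of a set is the dimension times the volume of the cone over it. The cone
over the cap fits in a ball of radius √(1 - a²), whose volume scales with the dimension-th power of
the radius. -/
theorem toSphere_cap_le {V : Type*} [NormedAddCommGroup V] [InnerProductSpace ℝ V]
    [MeasurableSpace V] [BorelSpace V] [FiniteDimensional ℝ V] (μ : Measure V)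
    [μ.IsAddHaarMeasure] {v : V} {a : ℝ} (hv : ‖v‖ = 1) (ha : 0 ≤ a) (ha2 : a ^ 2 ≤ 1 / 2) :
    μ.toSphere {x | a ≤ inner ℝ v x.1} ≤
      ENNReal.ofReal (√(1 - a ^ 2) ^ Module.finrank ℝ V) * μ.toSphere Set.univ := by
  have hm : MeasurableSet {x : Metric.sphere (0 : V) 1 | a ≤ inner ℝ v x.1} := by
    apply measurableSet_le <;> fun_prop
  rw [Measure.toSphere_apply' _ hm, Measure.toSphere_apply_univ, mul_left_comm]
  gcongr
  rw [← Measure.addHaar_closedBall μ (a • v) (Real.sqrt_nonneg _)]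
  apply measure_mono
  rintro _ ⟨r, ⟨hr0, hr1⟩, _, ⟨x, hx, rfl⟩, rfl⟩
  exact Real.le_sqrt_of_sq_le
    (dist_smul_sq_le_of_mem_cap hv (by simp) ha ha2 hr0.le hr1.le hx)

instance (n : ℕ) : IsProbabilityMeasure (haarState n) := by
  refine ⟨?_⟩
  rw [haarState, Measure.smul_apply, smul_eq_mul, ENNReal.inv_mul_cancel]
  · exact toSphere_univ_ne_zero n
  · exact measure_ne_top _ _

/-- The real dimension 2 · 2^n absorbs the square root in `toSphere_cap_le`. -/
theorem haarState_cap_le {n : ℕ} {v : EuclideanSpace ℂ (Bits n)} {a : ℝ} (hv : ‖v‖ = 1)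
    (ha : 0 ≤ a) (ha2 : a ^ 2 ≤ 1 / 2) :
    haarState n {x | a ≤ (inner ℂ v x.1).re} ≤ ENNReal.ofReal ((1 - a ^ 2) ^ (2 ^ n)) := by
  have hfin : Module.finrank ℝ (EuclideanSpace ℂ (Bits n)) = 2 * 2 ^ n := by
    rw [← Module.finrank_mul_finrank ℝ ℂ]
    simp
  have h := toSphere_cap_le (volume : Measure (EuclideanSpace ℂ (Bits n))) hv ha ha2
  have e : ∀ x : EuclideanSpace ℂ (Bits n), inner ℝ v x = (inner ℂ v x).re := by
    intro x
    simp [PiLp.inner_apply]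
  simp only [e] at h
  rw [hfin, pow_mul, Real.sq_sqrt (by linarith)] at h
  rw [haarState, Measure.smul_apply, smul_eq_mul]
  calc _ ≤ (volume.toSphere Set.univ)⁻¹ *
        (ENNReal.ofReal ((1 - a ^ 2) ^ (2 ^ n)) * volume.toSphere Set.univ) := by gcongr
    _ = _ := by
      rw [mul_comm, mul_assoc, ENNReal.mul_inv_cancel, mul_one]
      · exact toSphere_univ_ne_zero n
      · exact measure_ne_top _ _

/-- Eight unit complex numbers such that every complex number is close in direction to one. -/
noncomputable def phases : Finset ℂ :=
  {⟨4 / 5, 3 / 5⟩, ⟨4 / 5, -3 / 5⟩, ⟨-4 / 5, 3 / 5⟩, ⟨-4 / 5, -3 / 5⟩,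
    ⟨3 / 5, 4 / 5⟩, ⟨3 / 5, -4 / 5⟩, ⟨-3 / 5, 4 / 5⟩, ⟨-3 / 5, -4 / 5⟩}

theorem card_phases_le : phases.card ≤ 8 := by
  unfold phases
  repeat refine (Finset.card_insert_le _ _).trans (Nat.succ_le_succ ?_)
  simp

theorem norm_of_mem_phases {u : ℂ} (hu : u ∈ phases) : ‖u‖ = 1 := by
  rw [← sq_eq_sq₀ (norm_nonneg _) zero_le_one, ← Complex.normSq_eq_norm_sq, Complex.normSq_apply]
  simp only [phases, Finset.mem_insert, Finset.mem_singleton] at hu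
  rcases hu with rfl | rfl | rfl | rfl | rfl | rfl | rfl | rfl <;> norm_num

/-- Signs and order of the coordinates of `u` are matched to those of `z`. With p ≥ q ≥ 0 the
absolute coordinates of `z`, (4p + 3q)² - 16(p² + q²) = q(24p - 7q) ≥ 0. -/
theorem exists_phase (z : ℂ) : ∃ u ∈ phases, 4 / 5 * ‖z‖ ≤ (conj u * z).re := by
  have key : ∀ p q : ℝ, 0 ≤ q → q ≤ p → ‖z‖ ^ 2 = p ^ 2 + q ^ 2 →
      4 / 5 * ‖z‖ ≤ 4 / 5 * p + 3 / 5 * q := by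
    intro p q hq hqp h
    refine abs_le_of_sq_le_sq' ?_ (by linarith) |>.2
    nlinarith [mul_nonneg hq (sub_nonneg.2 hqp)]
  have hz : ‖z‖ ^ 2 = z.re ^ 2 + z.im ^ 2 := by
    rw [← Complex.normSq_eq_norm_sq, Complex.normSq_apply]; ring
  have hz' : ‖z‖ ^ 2 = z.im ^ 2 + z.re ^ 2 := by rw [hz, add_comm]
  simp only [Complex.mul_re, Complex.conj_re, Complex.conj_im]
  rcases le_total |z.im| |z.re| with h | h
  · have := key _ _ (abs_nonneg _) h (by simpa using hz)
    rcases abs_cases z.re with ⟨h1, -⟩ | ⟨h1, -⟩ <;> rcases abs_cases z.im with ⟨h2, -⟩ | ⟨h2, -⟩ <;>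
      rw [h1, h2] at this
    · exact ⟨⟨4 / 5, 3 / 5⟩, by simp [phases], by linarith⟩
    · exact ⟨⟨4 / 5, -3 / 5⟩, by simp [phases], by linarith⟩
    · exact ⟨⟨-4 / 5, 3 / 5⟩, by simp [phases], by linarith⟩
    · exact ⟨⟨-4 / 5, -3 / 5⟩, by simp [phases], by linarith⟩
  · have := key _ _ (abs_nonneg _) h (by simpa using hz')
    rcases abs_cases z.re with ⟨h1, -⟩ | ⟨h1, -⟩ <;> rcases abs_cases z.im with ⟨h2, -⟩ | ⟨h2, -⟩ <;>
      rw [h1, h2] at this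
    · exact ⟨⟨3 / 5, 4 / 5⟩, by simp [phases], by linarith⟩
    · exact ⟨⟨3 / 5, -4 / 5⟩, by simp [phases], by linarith⟩
    · exact ⟨⟨-3 / 5, 4 / 5⟩, by simp [phases], by linarith⟩
    · exact ⟨⟨-3 / 5, -4 / 5⟩, by simp [phases], by linarith⟩

/-- (7/10)³ = 0.343 < 1/e; this is where the rate 1/3 in the exponent comes from. -/
theorem seven_tenths_pow_le (N : ℕ) : (7 / 10 : ℝ) ^ N ≤ Real.exp (-((N : ℝ) / 3)) := by
  have h : (7 / 10 : ℝ) ≤ Real.exp (-(1 / 3)) := by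
    refine le_of_pow_le_pow_left₀ three_ne_zero (Real.exp_pos _).le ?_
    rw [← Real.exp_nat_mul, show ((3 : ℕ) : ℝ) * -(1 / 3) = -1 by norm_num, Real.exp_neg,
      le_inv_comm₀ (by norm_num) (Real.exp_pos _)]
    exact Real.exp_one_lt_d9.le.trans (by norm_num)
  calc (7 / 10 : ℝ) ^ N ≤ Real.exp (-(1 / 3)) ^ N := by gcongr
    _ = _ := by rw [← Real.exp_nat_mul]; ring_nf

/-- A Haar-random state is unlikely to have a large overlap with a fixed one. -/
theorem haarState_overlap_le {n : ℕ} (φ : PureState n) :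
    (haarState n).real {ψ | 12 / 25 ≤ ‖inner ℂ φ.1 ψ.1‖ ^ 2} ≤
      8 * Real.exp (-((2 : ℝ) ^ n / 3)) := by
  have hsub : {ψ : PureState n | 12 / 25 ≤ ‖inner ℂ φ.1 ψ.1‖ ^ 2} ⊆
      ⋃ u ∈ phases, {ψ : PureState n | √(3 / 10) ≤ (inner ℂ (u • φ.1) ψ.1).re} := by
    intro ψ hψ
    obtain ⟨u, hu, h⟩ := exists_phase (inner ℂ φ.1 ψ.1)
    simp only [Set.mem_iUnion]
    refine ⟨u, hu, ?_⟩
    rw [Set.mem_ofPred_eq, inner_smul_left]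
    refine le_trans ?_ h
    rw [Real.sqrt_le_left (by positivity)]
    rw [Set.mem_ofPred_eq] at hψ
    -- The constants fit because (4/5)² · 12/25 = 192/625 ≥ 3/10.
    nlinarith
  have hcap : ∀ u ∈ phases,
      (haarState n).real {ψ : PureState n | √(3 / 10) ≤ (inner ℂ (u • φ.1) ψ.1).re} ≤
        Real.exp (-((2 : ℝ) ^ n / 3)) := by
    intro u hu
    have hs : √(3 / 10 : ℝ) ^ 2 = 3 / 10 := Real.sq_sqrt (by norm_num)
    have h := haarState_cap_le (n := n) (v := u • φ.1) (a := √(3 / 10))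
      (by rw [norm_smul, norm_of_mem_phases hu]; simp) (Real.sqrt_nonneg _)
      (by rw [hs]; norm_num)
    rw [hs] at h
    refine (ENNReal.toReal_le_of_le_ofReal (by norm_num) h).trans ?_
    have := seven_tenths_pow_le (2 ^ n)
    push_cast at this
    rwa [show (1 - 3 / 10 : ℝ) = 7 / 10 by norm_num]
  calc _ ≤ (haarState n).real
        (⋃ u ∈ phases, {ψ : PureState n | √(3 / 10) ≤ (inner ℂ (u • φ.1) ψ.1).re}) :=
        measureReal_mono hsub (measure_ne_top _ _)
    _ ≤ ∑ u ∈ phases, (haarState n).real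
        {ψ : PureState n | √(3 / 10) ≤ (inner ℂ (u • φ.1) ψ.1).re} :=
        measureReal_biUnion_finset_le _ _
    _ ≤ phases.card • Real.exp (-((2 : ℝ) ^ n / 3)) := Finset.sum_le_card_nsmul _ _ _ hcap
    _ ≤ _ := by
      rw [nsmul_eq_mul]
      gcongr
      exact_mod_cast card_phases_le

/-! ### Output length of polynomial-time Turing machines -/

namespace Turing

/-- The largest number of symbols that a statement pushes. -/
def TM2.Stmt.pushes {K : Type*} {Γ : K → Type*} {Λ σ : Type*} : TM2.Stmt Γ Λ σ → ℕ
  | .push _ _ q => q.pushes + 1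
  | .peek _ _ q => q.pushes
  | .pop _ _ q => q.pushes
  | .load _ q => q.pushes
  | .branch _ q₁ q₂ => max q₁.pushes q₂.pushes
  | .goto _ => 0
  | .halt => 0

theorem TM2.length_stk_stepAux_le {K : Type*} [DecidableEq K] {Γ : K → Type*} {Λ σ : Type*}
    (q : TM2.Stmt Γ Λ σ) (v : σ) (S : ∀ k, List (Γ k)) (k : K) :
    ((TM2.stepAux q v S).stk k).length ≤ (S k).length + q.pushes := by
  induction q generalizing v S with
  | push k' f q ih =>
    refine (ih _ _).trans ?_
    rcases eq_or_ne k k' with rfl | h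
    · simp [TM2.Stmt.pushes]; omega
    · simp [TM2.Stmt.pushes, h]
  | peek k' f q ih => exact ih _ _
  | pop k' f q ih =>
    refine (ih _ _).trans ?_
    rcases eq_or_ne k k' with rfl | h
    · simp [TM2.Stmt.pushes]
    · simp [TM2.Stmt.pushes, h]
  | load f q ih => exact ih _ _
  | branch f q₁ q₂ ih₁ ih₂ =>
    simp only [TM2.stepAux, TM2.Stmt.pushes]
    cases f v
    · exact (ih₂ _ _).trans (by gcongr; exact le_max_right _ _)
    · exact (ih₁ _ _).trans (by gcongr; exact le_max_left _ _)
  | goto f => simp [TM2.stepAux]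
  | halt => simp [TM2.stepAux]

/-- One step executes the statement at one label. There are finitely many labels, so the number of
pushes per step is bounded. -/
theorem FinTM2.exists_length_stk_le (tm : FinTM2) : ∃ c : ℕ, ∀ (t : ℕ) (a b : tm.Cfg),
    (flip Bind.bind tm.step)^[t] (some a) = some b →
      ∀ k, (b.stk k).length ≤ (a.stk k).length + t * c := by
  have := tm.ΛFin
  refine ⟨Finset.univ.sup fun l => (tm.m l).pushes, fun t => ?_⟩
  induction t with
  | zero =>
    intro a b h k
    simp only [Function.iterate_zero, id, Option.some.injEq] at h
    simp [h]
  | succ t ih =>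
    intro a b h k
    rw [Function.iterate_succ_apply'] at h
    obtain ⟨c, hc, hcb⟩ := Option.bind_eq_some_iff.1 h
    refine le_trans ?_ (Nat.add_le_add_right (ih a c hc k) _ |>.trans_eq
      (by rw [Nat.succ_mul, add_assoc]))
    obtain ⟨l, v, S⟩ := c
    cases l with
    | none => simp [TM2.step] at hcb
    | some l =>
      simp only [FinTM2.step, TM2.step] at hcb
      obtain rfl := Option.some.inj hcb
      refine (TM2.length_stk_stepAux_le _ _ _ _).trans ?_
      gcongr
      exact Finset.le_sup (f := fun l => (tm.m l).pushes) (Finset.mem_univ l)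

theorem length_stk_initList_le (tm : FinTM2) (s : List (tm.Γ tm.k₀)) (k : tm.K) :
    ((initList tm s).stk k).length ≤ s.length := by
  simp only [initList]
  split_ifs with h
  · subst h; simp
  · simp

theorem stk_haltList (tm : FinTM2) (s : List (tm.Γ tm.k₁)) : (haltList tm s).stk tm.k₁ = s := by
  simp [haltList]

end Turing

/-- The output is the final content of one stack. That stack holds at most the input at the start
and grows by a bounded amount per step. -/
theorem PolyTime.exists_length_le {f : List Bool → List Bool} (hf : PolyTime f) :
    ∃ p : Polynomial ℕ, ∀ x, (f x).length ≤ p.eval x.length := by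
  obtain ⟨h⟩ := hf
  obtain ⟨c, hc⟩ := h.tm.exists_length_stk_le
  refine ⟨Polynomial.X + h.time * Polynomial.C c, fun x => ?_⟩
  have ho := h.outputsFun x
  have h1 := hc _ _ _ ho.evals_in_steps h.tm.k₁
  rw [Turing.stk_haltList] at h1
  have h2 := Turing.length_stk_initList_le h.tm (List.map h.inputAlphabet.invFun (id x)) h.tm.k₁
  have h3 := ho.steps_le_m
  simp only [List.length_map, id] at h1 h2 h3
  simp only [Polynomial.eval_add, Polynomial.eval_X, Polynomial.eval_mul, Polynomial.eval_C]
  exact h1.trans (add_le_add h2 (Nat.mul_le_mul_right _ h3))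

theorem polyTime_id : PolyTime id := ⟨Turing.idComputableInPolyTime _⟩

/-! ### Polynomial bounds -/

theorem PolyBounded.mono {g h : ℕ → ℕ} (hh : PolyBounded h) (H : ∀ κ, g κ ≤ h κ) :
    PolyBounded g := by
  obtain ⟨p, hp⟩ := hh
  exact ⟨p, fun κ => (H κ).trans (hp κ)⟩

theorem PolyBounded.add {g h : ℕ → ℕ} (hg : PolyBounded g) (hh : PolyBounded h) :
    PolyBounded fun κ => g κ + h κ := by
  obtain ⟨p, hp⟩ := hg
  obtain ⟨q, hq⟩ := hh
  exact ⟨p + q, fun κ => by simpa using add_le_add (hp κ) (hq κ)⟩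

theorem PolyBounded.mul_const {g : ℕ → ℕ} (hg : PolyBounded g) (c : ℕ) :
    PolyBounded fun κ => g κ * c := by
  obtain ⟨p, hp⟩ := hg
  exact ⟨p * Polynomial.C c, fun κ => by simpa using Nat.mul_le_mul_right c (hp κ)⟩

theorem polyBounded_const (c : ℕ) : PolyBounded fun _ => c := ⟨Polynomial.C c, by simp⟩

theorem polyBounded_id : PolyBounded fun κ => κ := ⟨Polynomial.X, by simp⟩

theorem Polynomial.eval_mono_nat (p : Polynomial ℕ) : Monotone fun n => p.eval n := by
  intro a b h
  simp only [Polynomial.eval_eq_sum_range]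
  gcongr

theorem PolyBounded.eval {g : ℕ → ℕ} (hg : PolyBounded g) (p : Polynomial ℕ) :
    PolyBounded fun κ => p.eval (g κ) := by
  obtain ⟨q, hq⟩ := hg
  exact ⟨p.comp q, fun κ => by
    rw [Polynomial.eval_comp]; exact p.eval_mono_nat (hq κ)⟩

theorem PolyTime.polyBounded {f : List Bool → List Bool} (hf : PolyTime f) {x : ℕ → List Bool}
    (hx : PolyBounded fun κ => (x κ).length) : PolyBounded fun κ => (f (x κ)).length := by
  obtain ⟨p, hp⟩ := hf.exists_length_le
  exact (hx.eval p).mono fun κ => hp _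

/-! ### Size of the described circuit -/

/-- A number `n` costs `n + 1` symbols to write in unary. -/
theorem sum_readUnary_add_length_le (a : ℕ) (s : List Bool) :
    (readUnary a s).sum + (readUnary a s).length ≤ a + s.length := by
  induction s generalizing a with
  | nil => simp [readUnary]
  | cons b s ih =>
    cases b
    · have := ih 0
      simp [readUnary]; omega
    · have := ih (a + 1)
      simp [readUnary]; omega

/-- No gate costs more than the number of entries that its code consumes, even if its wire list is
cut short by the end of `l`. -/
theorem sum_cost_readGates_le (l : List ℕ) :
    ((readGates l).map Gate.cost).sum ≤ l.length := by
  induction l using readGates.induct <;>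
    rw [readGates] <;> simp_all [Gate.cost] <;> omega

/-- The numbers of input and output wires and the size of the circuit that a string describes are
bounded by the length of the string. -/
theorem decodeCircuit_le (s : List Bool) : (decodeCircuit s).1 ≤ s.length ∧
    (decodeCircuit s).2.1 ≤ s.length ∧
    (decodeCircuit s).2.2.size Gate.cost ≤ s.length := by
  have h := sum_readUnary_add_length_le 0 s
  have H : (∃ d o w l, readUnary 0 s = d :: o :: w :: l ∧
      decodeCircuit s = ⟨d, o, ⟨w, readGates l⟩⟩) ∨ decodeCircuit s = ⟨0, 0, ⟨0, []⟩⟩ := by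
    unfold decodeCircuit
    split
    · next d o w l hl => exact Or.inl ⟨d, o, w, l, hl, rfl⟩
    · exact Or.inr rfl
  generalize decodeCircuit s = D at H
  obtain ⟨d, o, w, l, hl, rfl⟩ | rfl := H
  · have := sum_cost_readGates_le l
    simp only [Circuit.size, Circuit.wires]
    simp only [hl, List.sum_cons, List.length_cons] at h
    omega
  · simp [Circuit.size, Circuit.wires]

/-! ### Operators on some of the wires -/

section Embed

variable {m N : ℕ} {ws : Fin m → Fin N}

/-- A string that is `w` on the wires `ws` and agrees with `x` elsewhere. -/
noncomputable def graft (ws : Fin m → Fin N) (w : Bits m) (x : Bits N) : Bits N :=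
  Function.extend ws w x

theorem graft_comp (hws : Function.Injective ws) (w : Bits m) (x : Bits N) :
    graft ws w x ∘ ws = w := by
  ext j; simp [graft, hws.extend_apply]

theorem graft_apply_of_forall_ne {w : Bits m} {x : Bits N} {i : Fin N} (hi : ∀ j, ws j ≠ i) :
    graft ws w x i = x i :=
  Function.extend_apply' _ _ _ (by simpa using hi)

theorem graft_eq_iff (hws : Function.Injective ws) {w : Bits m} {x z : Bits N} :
    graft ws w x = z ↔ z ∘ ws = w ∧ ∀ i, (∀ j, ws j ≠ i) → x i = z i := by
  constructor
  · rintro rfl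
    exact ⟨graft_comp hws w x, fun i hi => (graft_apply_of_forall_ne hi).symm⟩
  · rintro ⟨rfl, h⟩
    ext i
    by_cases hi : ∃ j, ws j = i
    · obtain ⟨j, rfl⟩ := hi
      simp [graft, hws.extend_apply]
    · push Not at hi
      rw [graft_apply_of_forall_ne hi, h i hi]

/-- Summing over the strings that agree with `x` off the wires `ws`. -/
theorem sum_agree_off {R : Type*} [AddCommMonoid R] (hws : Function.Injective ws) (x : Bits N)
    (F : Bits N → R) :
    ∑ z, (if ∀ i, (∀ j, ws j ≠ i) → x i = z i then F z else 0) = ∑ w, F (graft ws w x) := by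
  rw [← Finset.sum_filter]
  symm
  refine Finset.sum_bij' (fun w _ => graft ws w x) (fun z _ => z ∘ ws) ?_ ?_ ?_ ?_ ?_
  · intro w _
    simp only [Finset.mem_filter, Finset.mem_univ, true_and]
    exact fun i hi => (graft_apply_of_forall_ne hi).symm
  · simp
  · intro w _
    exact graft_comp hws w x
  · intro z hz
    exact (graft_eq_iff hws).2 ⟨rfl, by simpa using hz⟩
  · simp

/-- Only intermediate strings that agree with `x` off the wires contribute, and these are indexed by
their values on the wires. With the next two lemmas, `embedMatrix` is a unital *-homomorphism and so
preserves unitarity. -/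
theorem embedMatrix_mul (hws : Function.Injective ws) (A B : QMat m) :
    embedMatrix N ws (A * B) = embedMatrix N ws A * embedMatrix N ws B := by
  ext x y
  rw [Matrix.mul_apply]
  have h1 : ∀ z, embedMatrix N ws A x z * embedMatrix N ws B z y =
      if ∀ i, (∀ j, ws j ≠ i) → x i = z i then A (x ∘ ws) (z ∘ ws) *
        embedMatrix N ws B z y else 0 := by
    intro z
    simp only [embedMatrix]
    split_ifs <;> simp
  simp only [h1]
  rw [sum_agree_off hws x (fun z => A (x ∘ ws) (z ∘ ws) * embedMatrix N ws B z y)]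
  simp only [embedMatrix, graft_comp hws, Matrix.mul_apply]
  have h2 : ∀ w, (∀ i, (∀ j, ws j ≠ i) → graft ws w x i = y i) ↔
      ∀ i, (∀ j, ws j ≠ i) → x i = y i := by
    intro w
    refine forall₂_congr fun i hi => ?_
    rw [graft_apply_of_forall_ne hi]
  simp only [h2]
  split_ifs <;> simp

theorem embedMatrix_one (hws : Function.Injective ws) : embedMatrix N ws 1 = 1 := by
  ext x y
  simp only [embedMatrix, Matrix.one_apply]
  have : x = y ↔ (x ∘ ws = y ∘ ws ∧ ∀ i, (∀ j, ws j ≠ i) → x i = y i) := by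
    constructor
    · rintro rfl; simp
    · rintro ⟨h, h'⟩
      have := (graft_eq_iff hws).2 ⟨h, fun i hi => (h' i hi).symm⟩
      rw [← this, graft_eq_iff hws]
      simp
  simp only [this]
  split_ifs <;> simp_all

theorem embedMatrix_conjTranspose (A : QMat m) :
    embedMatrix N ws A.conjTranspose = (embedMatrix N ws A).conjTranspose := by
  ext x y
  simp only [embedMatrix, Matrix.conjTranspose_apply]
  have : (∀ i, (∀ j, ws j ≠ i) → x i = y i) ↔ (∀ i, (∀ j, ws j ≠ i) → y i = x i) :=
    forall₂_congr fun i _ => eq_comm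
  simp only [this]
  split_ifs <;> simp

theorem embedMatrix_mem_unitary (hws : Function.Injective ws) {A : QMat m}
    (hA : A ∈ Matrix.unitaryGroup (Bits m) ℂ) :
    embedMatrix N ws A ∈ Matrix.unitaryGroup (Bits N) ℂ := by
  rw [Matrix.mem_unitaryGroup_iff'] at hA ⊢
  rw [Matrix.star_eq_conjTranspose] at hA ⊢
  rw [← embedMatrix_conjTranspose, ← embedMatrix_mul hws, hA, embedMatrix_one hws]

theorem embedMatrix_embedMatrix {K : ℕ} {us : Fin N → Fin K} (hus : Function.Injective us)
    (A : QMat m) : embedMatrix K us (embedMatrix N ws A) = embedMatrix K (us ∘ ws) A := by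
  ext x y
  simp only [embedMatrix, ← ite_and, ← Function.comp_assoc]
  refine if_congr ?_ rfl rfl
  constructor
  · rintro ⟨h1, h2⟩ i hi
    by_cases h : ∃ j, us j = i
    · obtain ⟨j, rfl⟩ := h
      exact h2 j fun k hk => hi k (by simp [hk])
    · push Not at h
      exact h1 i h
  · intro h
    refine ⟨fun i hi => h i fun j => hi _, fun i hi => h (us i) fun j hj => hi j (hus hj)⟩

/-- The matrix of the map `g` on the computational basis. -/
def basisMapMatrix {α : Type*} [DecidableEq α] (g : α → α) : Matrix α α ℂ :=
  fun x y => if x = g y then 1 else 0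

theorem basisMapMatrix_mul {α : Type*} [DecidableEq α] [Fintype α] (g h : α → α) :
    basisMapMatrix g * basisMapMatrix h = basisMapMatrix (g ∘ h) := by
  ext x y
  simp [basisMapMatrix, Matrix.mul_apply]

theorem basisMapMatrix_mem_unitary {α : Type*} [DecidableEq α] [Fintype α] {g : α → α}
    (hg : Function.Injective g) : basisMapMatrix g ∈ Matrix.unitaryGroup α ℂ := by
  rw [Matrix.mem_unitaryGroup_iff', Matrix.star_eq_conjTranspose]
  ext x y
  simp only [basisMapMatrix, Matrix.mul_apply, Matrix.conjTranspose_apply, Matrix.one_apply,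
    apply_ite star, star_one, star_zero, ite_mul, one_mul, zero_mul, Finset.sum_ite_eq',
    Finset.mem_univ, if_true, hg.eq_iff]

/-- The diagonal of `ρ` after the basis has been permuted. -/
theorem sum_diag_basisMapMatrix {α : Type*} [DecidableEq α] [Fintype α] {g : α → α}
    (hg : Function.Injective g) (ρ : Matrix α α ℂ) (p : α → Prop) [DecidablePred p] :
    ∑ x, (if p x then
        ((basisMapMatrix g * ρ * (basisMapMatrix g).conjTranspose) x x).re else 0) =
      ∑ x, if p (g x) then (ρ x x).re else 0 := by
  have hb : Function.Bijective g := Finite.injective_iff_bijective.1 hg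
  rw [← hb.sum_comp]
  refine Finset.sum_congr rfl fun x _ => ?_
  congr 2
  simp [basisMapMatrix, Matrix.mul_apply, hg.eq_iff, apply_ite star]

theorem embedMatrix_basisMapMatrix (hws : Function.Injective ws) (g : Bits m → Bits m) :
    embedMatrix N ws (basisMapMatrix g) =
      basisMapMatrix fun y => graft ws (g (y ∘ ws)) y := by
  ext x y
  simp only [embedMatrix, basisMapMatrix, ← ite_and, eq_comm (a := x) (b := graft _ _ _),
    graft_eq_iff hws, eq_comm (a := x _) (b := y _), and_comm]

end Embed

/-! ### Gates are unitary -/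

theorem applyOn_mem_unitary (N : ℕ) (ws : List ℕ) {M : QMat ws.length}
    (hM : M ∈ Matrix.unitaryGroup (Bits ws.length) ℂ) :
    applyOn N ws M ∈ Matrix.unitaryGroup (Bits N) ℂ := by
  unfold applyOn
  split_ifs with h
  · refine embedMatrix_mem_unitary (fun i j hij => ?_) hM
    exact h.1.injective_get (Fin.mk.inj hij)
  · exact one_mem _

theorem sum_bits_one (F : Bits 1 → ℂ) : ∑ x, F x = F ![false] + F ![true] := by
  rw [← (Equiv.funUnique (Fin 1) Bool).symm.sum_comp]
  simp [add_comm]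
  congr 1 <;> congr 1 <;> ext i <;> fin_cases i <;> rfl

theorem bits_one_eq (x : Bits 1) : x = ![false] ∨ x = ![true] := by
  rcases h : x 0
  · left; ext i; fin_cases i; exact h
  · right; ext i; fin_cases i; exact h

theorem hadamardMatrix_mem_unitary : hadamardMatrix ∈ Matrix.unitaryGroup (Bits 1) ℂ := by
  have hs : ((Real.sqrt 2 : ℝ) : ℂ)⁻¹ * ((Real.sqrt 2 : ℝ) : ℂ)⁻¹ = 1 / 2 := by
    rw [← mul_inv, ← Complex.ofReal_mul, Real.mul_self_sqrt (by norm_num)]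
    simp
  rw [Matrix.mem_unitaryGroup_iff', Matrix.star_eq_conjTranspose]
  ext x y
  rw [Matrix.mul_apply, sum_bits_one]
  rcases bits_one_eq x with rfl | rfl <;> rcases bits_one_eq y with rfl | rfl <;>
    simp [hadamardMatrix, hs] <;> norm_num

theorem tMatrix_mem_unitary : tMatrix ∈ Matrix.unitaryGroup (Bits 1) ℂ := by
  rw [Matrix.mem_unitaryGroup_iff', Matrix.star_eq_conjTranspose, tMatrix,
    Matrix.diagonal_conjTranspose, Matrix.diagonal_mul_diagonal, ← Matrix.diagonal_one]
  congr 1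
  ext x
  simp only [Pi.star_apply]
  split_ifs
  · rw [Complex.star_def, ← Complex.exp_conj, ← Complex.exp_add]
    simp [div_eq_mul_inv, Complex.conj_ofNat]
  · simp

theorem cnotMatrix_eq :
    cnotMatrix = basisMapMatrix fun y : Bits 2 => ![y 0, xor (y 1) (y 0)] := rfl

theorem cnot_injective :
    Function.Injective fun y : Bits 2 => (![y 0, xor (y 1) (y 0)] : Bits 2) := by
  intro x y h
  have h0 : x 0 = y 0 := congrFun h 0
  have h1 : xor (x 1) (x 0) = xor (y 1) (y 0) := congrFun h 1
  rw [h0, Bool.xor_left_inj] at h1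
  ext i
  fin_cases i
  · exact h0
  · exact h1

/-- The matrix is block diagonal in the control bit, with blocks 1 and `M`. -/
theorem controlledMatrix_mem_unitary {m : ℕ} {M : QMat m}
    (hM : M ∈ Matrix.unitaryGroup (Bits m) ℂ) :
    controlledMatrix M ∈ Matrix.unitaryGroup (Bits (m + 1)) ℂ := by
  rw [Matrix.mem_unitaryGroup_iff', Matrix.star_eq_conjTranspose] at hM ⊢
  ext x y
  induction x using Fin.consCases with | _ a x
  induction y using Fin.consCases with | _ b y
  have hM' : ∀ x y, ∑ z, conj (M z x) * M z y = (1 : QMat m) x y := by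
    intro x y
    rw [← hM, Matrix.mul_apply]; rfl
  rw [Matrix.mul_apply, ← (Fin.consEquiv fun _ => Bool).sum_comp, Fintype.sum_prod_type]
  have h0 : ∀ p : Bool × Bits m, Fin.consEquiv (fun _ => Bool) p 0 = p.1 := fun _ => rfl
  have ht : ∀ p : Bool × Bits m, Fin.tail (Fin.consEquiv (fun _ => Bool) p) = p.2 := fun _ => rfl
  simp only [controlledMatrix, h0, ht, Fin.cons_zero, Fin.tail_cons,
    Matrix.conjTranspose_apply, Fintype.sum_bool, Matrix.one_apply, Fin.cons_inj]
  cases a <;> cases b <;>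
    simp [Matrix.one_apply, hM', apply_ite, eq_comm]

theorem queryMatrix_mem_unitary (U : QuantumOracle) (adj : Bool) (m : ℕ) :
    U.queryMatrix adj m ∈ Matrix.unitaryGroup (Bits m) ℂ := by
  unfold QuantumOracle.queryMatrix
  split_ifs
  · exact Unitary.star_mem (U m).2
  · exact (U m).2

/-- Unitarity makes `measureProb` of a run a genuine probability. Language gates need no
counterpart, because `Circuit.measureProb_thenAsk` reduces to circuits without them. -/
theorem Gate.matrix_mem_unitary (U : QuantumOracle) (N : ℕ) (g : Gate) :
    g.matrix U N ∈ Matrix.unitaryGroup (Bits N) ℂ := by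
  cases g with
  | hadamard a => exact applyOn_mem_unitary N [a] hadamardMatrix_mem_unitary
  | tGate a => exact applyOn_mem_unitary N [a] tMatrix_mem_unitary
  | cnot a b => exact applyOn_mem_unitary N [a, b] (basisMapMatrix_mem_unitary cnot_injective)
  | query adj ws => exact applyOn_mem_unitary N ws (queryMatrix_mem_unitary U adj _)
  | cquery adj c ws =>
    exact applyOn_mem_unitary N (c :: ws)
      (controlledMatrix_mem_unitary (queryMatrix_mem_unitary U adj _))

/-! ### Measurement statistics of circuits -/

theorem castLE_ne_iff {d N : ℕ} (h : d ≤ N) (i : Fin N) :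
    (∀ j : Fin d, Fin.castLE h j ≠ i) ↔ d ≤ i.1 := by
  constructor
  · intro H
    by_contra hi
    exact H ⟨i.1, by omega⟩ rfl
  · rintro H j rfl
    simp at H
    omega

/-- Summing over the strings that vanish from position `d` on. -/
theorem sum_vanish_from {R : Type*} [AddCommMonoid R] {d N : ℕ} (h : d ≤ N) (F : Bits N → R) :
    ∑ z : Bits N, (if ∀ i : Fin N, d ≤ i.1 → z i = false then F z else 0) =
      ∑ w : Bits d, F (graft (Fin.castLE h) w fun _ => false) := by
  rw [← sum_agree_off (Fin.castLE_injective h)]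
  refine Finset.sum_congr rfl fun z _ => if_congr ?_ rfl rfl
  refine forall_congr' fun i => ?_
  rw [castLE_ne_iff, eq_comm]

namespace Circuit

variable {γ : Type} {d o : ℕ}

/-- The state of all wires at the end of the computation. -/
noncomputable def finalState (sem : ∀ N : ℕ, γ → QMat N) (C : Circuit γ d o) (ρ : QMat d) :
    QMat C.wires :=
  C.operator sem * C.initialState ρ * (C.operator sem).conjTranspose

theorem input_le_wires (C : Circuit γ d o) : d ≤ C.wires :=
  le_trans (le_max_left _ _) (le_max_right _ _)

theorem output_le_wires (C : Circuit γ d o) : o ≤ C.wires :=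
  le_trans (le_max_right _ _) (le_max_right _ _)

theorem traceOut_diag (C : Circuit γ d o) (τ : QMat C.wires) (a : Bits o) :
    C.traceOut τ a a =
      ∑ x, if x ∘ Fin.castLE C.output_le_wires = a then τ x x else 0 := by
  unfold traceOut
  refine Finset.sum_congr rfl fun x _ => ?_
  rw [Finset.sum_eq_single x]
  · simp
  · intro y _ hyx
    rw [if_neg]
    rintro ⟨h1, h2, h3⟩
    apply hyx
    ext i
    rcases lt_or_ge i.1 o with hi | hi
    · have := congrFun (h2.trans h1.symm) ⟨i.1, hi⟩
      exact this
    · exact (h3 i hi).symm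
  · simp

-- Measuring the output amounts to measuring all wires and ignoring the rest: only diagonal entries
-- of the final state survive the partial trace.
open Classical in
theorem measureProb_run (sem : ∀ N : ℕ, γ → QMat N) (C : Circuit γ d o) (ρ : QMat d)
    (S : Set (Bits o)) :
    measureProb (C.run sem ρ) S =
      ∑ x, if x ∘ Fin.castLE C.output_le_wires ∈ S then (C.finalState sem ρ x x).re else 0 := by
  have hr : C.run sem ρ = C.traceOut (C.finalState sem ρ) := rfl
  rw [hr, measureProb]
  generalize C.finalState sem ρ = τ
  calc _ = ∑ y : Bits o, ∑ x, if y ∈ S then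
        (if x ∘ Fin.castLE C.output_le_wires = y then (τ x x).re else 0) else 0 := by
        refine Finset.sum_congr rfl fun y _ => ?_
        rw [traceOut_diag, Complex.re_sum]
        split_ifs <;> simp [apply_ite Complex.re]
    _ = _ := by
        rw [Finset.sum_comm]
        refine Finset.sum_congr rfl fun x _ => ?_
        rw [Finset.sum_eq_single (x ∘ Fin.castLE C.output_le_wires)]
        · simp
        · intro y _ hy
          simp [hy.symm]
        · simp

/-- `ρ` is pulled back along restriction to the input wires and then compressed by a diagonal
projector; both operations preserve positivity. -/
theorem initialState_posSemidef (C : Circuit γ d o) {ρ : QMat d} (hρ : ρ.PosSemidef) :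
    (C.initialState ρ).PosSemidef := by
  have h := (hρ.submatrix fun x : Bits C.wires => x ∘ Fin.castLE C.input_le_wires)
    |>.mul_mul_conjTranspose_same
      (Matrix.diagonal fun x => if ∀ i : Fin C.wires, d ≤ i.1 → x i = false then 1 else 0)
  convert h using 1
  ext x y
  rw [Matrix.diagonal_conjTranspose, Matrix.mul_diagonal, Matrix.diagonal_mul]
  simp only [initialState, Pi.star_apply, apply_ite star, star_one, star_zero,
    Matrix.submatrix_apply, forall_and]
  split_ifs <;> simp_all

theorem trace_initialState (C : Circuit γ d o) (ρ : QMat d) :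
    (C.initialState ρ).trace = ρ.trace := by
  simp only [Matrix.trace, Matrix.diag, initialState, and_self]
  rw [sum_vanish_from C.input_le_wires (fun x => ρ (x ∘ Fin.castLE C.input_le_wires) _)]
  simp only [graft_comp (Fin.castLE_injective C.input_le_wires)]

theorem foldl_operator_mul (sem : ∀ N : ℕ, γ → QMat N) {N : ℕ} (l : List γ) (M : QMat N) :
    l.foldl (fun M g => sem N g * M) M = l.foldl (fun M g => sem N g * M) 1 * M := by
  induction l generalizing M with
  | nil => simp
  | cons g l ih =>
    rw [List.foldl_cons, List.foldl_cons, ih, ih (sem N g * 1), mul_one, mul_assoc]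

theorem foldl_operator_mem_unitary {sem : ∀ N : ℕ, γ → QMat N}
    (hsem : ∀ N g, sem N g ∈ Matrix.unitaryGroup (Bits N) ℂ) {N : ℕ} (l : List γ) :
    l.foldl (fun M g => sem N g * M) 1 ∈ Matrix.unitaryGroup (Bits N) ℂ := by
  induction l with
  | nil => exact one_mem _
  | cons g l ih =>
    rw [List.foldl_cons, foldl_operator_mul, mul_one]
    exact mul_mem ih (hsem N g)

section Unitary

variable {sem : ∀ N : ℕ, γ → QMat N} {ρ : QMat d}

theorem isMixedState_finalState
    (hsem : ∀ N g, sem N g ∈ Matrix.unitaryGroup (Bits N) ℂ) (C : Circuit γ d o)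
    (hρ : IsMixedState ρ) :
    IsMixedState (C.finalState sem ρ) := by
  refine ⟨(C.initialState_posSemidef hρ.1).mul_mul_conjTranspose_same _, ?_⟩
  have h : (C.operator sem).conjTranspose * C.operator sem = 1 :=
    Matrix.mem_unitaryGroup_iff'.1 (foldl_operator_mem_unitary hsem C.gates)
  rw [finalState, Matrix.trace_mul_cycle, h, one_mul, trace_initialState, hρ.2]

theorem finalState_diag_nonneg
    (hsem : ∀ N g, sem N g ∈ Matrix.unitaryGroup (Bits N) ℂ) (C : Circuit γ d o)
    (hρ : IsMixedState ρ)
    (x : Bits C.wires) : 0 ≤ (C.finalState sem ρ x x).re :=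
  (Complex.nonneg_iff.1 ((isMixedState_finalState hsem C hρ).1.diag_nonneg (i := x))).1

theorem measureProb_run_nonneg
    (hsem : ∀ N g, sem N g ∈ Matrix.unitaryGroup (Bits N) ℂ) (C : Circuit γ d o)
    (hρ : IsMixedState ρ)
    (S : Set (Bits o)) : 0 ≤ measureProb (C.run sem ρ) S := by
  classical
  rw [measureProb_run]
  refine Finset.sum_nonneg fun x _ => ?_
  split_ifs
  · exact finalState_diag_nonneg hsem C hρ x
  · exact le_rfl

theorem measureProb_run_mono
    (hsem : ∀ N g, sem N g ∈ Matrix.unitaryGroup (Bits N) ℂ) (C : Circuit γ d o)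
    (hρ : IsMixedState ρ)
    {S S' : Set (Bits o)} (h : S ⊆ S') :
    measureProb (C.run sem ρ) S ≤ measureProb (C.run sem ρ) S' := by
  classical
  rw [measureProb_run, measureProb_run]
  refine Finset.sum_le_sum fun x _ => ?_
  have := finalState_diag_nonneg hsem C hρ x
  split_ifs with h1 h2 h2
  · exact le_rfl
  · exact absurd (h h1) h2
  · exact this
  · exact le_rfl

theorem measureProb_run_add_compl
    (hsem : ∀ N g, sem N g ∈ Matrix.unitaryGroup (Bits N) ℂ) (C : Circuit γ d o)
    (hρ : IsMixedState ρ)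
    (S : Set (Bits o)) :
    measureProb (C.run sem ρ) S + measureProb (C.run sem ρ) Sᶜ = 1 := by
  classical
  rw [measureProb_run, measureProb_run, ← Finset.sum_add_distrib]
  have h := congrArg Complex.re (isMixedState_finalState hsem C hρ).2
  rw [Matrix.trace, Complex.re_sum, Complex.one_re] at h
  rw [← h]
  refine Finset.sum_congr rfl fun x _ => ?_
  simp only [Set.mem_compl_iff, Matrix.diag]
  split_ifs <;> simp_all

end Unitary

end Circuit

theorem isMixedState_ketbra {n : ℕ} (x : Bits n) : IsMixedState (ketbra x) := by
  constructor
  · rw [ketbra, ← Matrix.diagonal_single]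
    refine Matrix.PosSemidef.diagonal fun i => ?_
    by_cases h : i = x
    · subst h; simp
    · simp [h]
  · simp [ketbra]

theorem PureState.sum_mul_conj {n : ℕ} (ψ : PureState n) : ∑ x, ψ.1 x * conj (ψ.1 x) = 1 := by
  have h : ‖ψ.1‖ ^ 2 = 1 := by simp
  rw [EuclideanSpace.norm_sq_eq] at h
  simp only [Complex.mul_conj, Complex.normSq_eq_norm_sq]
  exact_mod_cast h

theorem PureState.isMixedState_tensorPower {n : ℕ} (ψ : PureState n) (T : ℕ) :
    IsMixedState (tensorPower T ψ.proj) := by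
  constructor
  · convert Matrix.posSemidef_vecMulVec_self_star fun x : Bits (T * n) =>
      ∏ t : Fin T, ψ.1 fun j => x (finProdFinEquiv (t, j)) using 1
    ext x y
    simp [tensorPower, PureState.proj, Matrix.vecMulVec_apply, Finset.prod_mul_distrib]
  · let e : Bits (T * n) ≃ (Fin T → Bits n) :=
      (Equiv.arrowCongr finProdFinEquiv.symm (Equiv.refl Bool)).trans (Equiv.curry _ _ _)
    have h : ∀ x, tensorPower T ψ.proj x x = ∏ t, ψ.proj (e x t) (e x t) := fun _ => rfl
    simp only [Matrix.trace, Matrix.diag, h]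
    rw [e.sum_comp fun z => ∏ t, ψ.proj (z t) (z t),
      ← Fintype.sum_pow (fun x => ψ.proj x x)]
    simp [PureState.proj, ψ.sum_mul_conj]

theorem PureState.isMixedState_proj {n : ℕ} (ψ : PureState n) : IsMixedState ψ.proj := by
  constructor
  · exact Matrix.posSemidef_vecMulVec_self_star _
  · exact ψ.sum_mul_conj

theorem PureState.trace_proj_mul_proj {n : ℕ} (φ ψ : PureState n) :
    (φ.proj * ψ.proj).trace.re = ‖inner ℂ φ.1 ψ.1‖ ^ 2 := by
  have h : (φ.proj * ψ.proj).trace = inner ℂ φ.1 ψ.1 * conj (inner ℂ φ.1 ψ.1) := by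
    simp only [Matrix.trace, Matrix.diag, Matrix.mul_apply, PureState.proj, PiLp.inner_apply,
      map_sum, Finset.sum_mul_sum]
    rw [Finset.sum_comm]
    refine Finset.sum_congr rfl fun x _ => Finset.sum_congr rfl fun y _ => ?_
    simp
    ring
  rw [h, Complex.mul_conj, Complex.normSq_eq_norm_sq, Complex.ofReal_re]

/-! ### Wider registers -/

/-- The listed wires are distinct and exist. -/
def ValidWires (N : ℕ) (ws : List ℕ) : Prop := ws.Nodup ∧ ∀ a ∈ ws, a < N

instance (N : ℕ) (ws : List ℕ) : Decidable (ValidWires N ws) :=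
  inferInstanceAs (Decidable (_ ∧ _))

/-- The listed wires, as a function. -/
def ValidWires.wire {N : ℕ} {ws : List ℕ} (h : ValidWires N ws) (j : Fin ws.length) : Fin N :=
  ⟨ws.get j, h.2 _ (List.get_mem ws j)⟩

theorem ValidWires.wire_injective {N : ℕ} {ws : List ℕ} (h : ValidWires N ws) :
    Function.Injective h.wire :=
  fun _ _ hij => h.1.injective_get (Fin.mk.inj hij)

theorem applyOn_of_valid {N : ℕ} {ws : List ℕ} (h : ValidWires N ws) (M : QMat ws.length) :
    applyOn N ws M = embedMatrix N h.wire M :=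
  dif_pos h

theorem applyOn_of_not_valid {N : ℕ} {ws : List ℕ} (h : ¬ValidWires N ws) (M : QMat ws.length) :
    applyOn N ws M = 1 :=
  dif_neg h

theorem applyOn_wider {N K : ℕ} (hNK : N ≤ K) {ws : List ℕ} (h : ValidWires N ws)
    (M : QMat ws.length) :
    applyOn K ws M = embedMatrix K (Fin.castLE hNK) (applyOn N ws M) := by
  have hK : ValidWires K ws := ⟨h.1, fun a ha => (h.2 a ha).trans_le hNK⟩
  rw [applyOn_of_valid h, applyOn_of_valid hK,
    embedMatrix_embedMatrix (Fin.castLE_injective hNK)]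
  rfl

/-- The wires of a gate. -/
def Gate.wireList : Gate → List ℕ
  | .hadamard a => [a]
  | .tGate a => [a]
  | .cnot a b => [a, b]
  | .query _ ws => ws
  | .cquery _ c ws => c :: ws

theorem Gate.matrix_of_not_valid (U : QuantumOracle) {N : ℕ} {g : Gate}
    (h : ¬ValidWires N g.wireList) : g.matrix U N = 1 := by
  cases g <;> exact applyOn_of_not_valid h _

theorem Gate.matrix_wider (U : QuantumOracle) {N K : ℕ} (hNK : N ≤ K) {g : Gate}
    (h : ValidWires N g.wireList) :
    g.matrix U K = embedMatrix K (Fin.castLE hNK) (g.matrix U N) := by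
  cases g <;> exact applyOn_wider hNK h _

/-- A gate naming a nonexistent wire does nothing on `N` wires but could act on `K` wires. Hence the
malformed gates are filtered out first. -/
theorem foldl_operator_wider (U : QuantumOracle) (L : Set (List Bool)) {N K : ℕ} (hNK : N ≤ K)
    (l : List Gate) :
    ((l.filter fun g => ValidWires N g.wireList).map LGate.base).foldl
        (fun M g => g.matrix U L K * M) 1 =
      embedMatrix K (Fin.castLE hNK) (l.foldl (fun M g => g.matrix U N * M) 1) := by
  have hi := Fin.castLE_injective hNK
  induction l with
  | nil => simp [embedMatrix_one hi]
  | cons g l ih =>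
    rw [List.foldl_cons, Circuit.foldl_operator_mul (Gate.matrix U), mul_one,
      embedMatrix_mul hi, ← ih]
    by_cases h : ValidWires N g.wireList
    · rw [List.filter_cons_of_pos (by simpa using h), List.map_cons, List.foldl_cons,
        Circuit.foldl_operator_mul (LGate.matrix U L), mul_one, LGate.matrix,
        Gate.matrix_wider U hNK h]
    · rw [List.filter_cons_of_neg (by simpa using h), Gate.matrix_of_not_valid U h,
        embedMatrix_one hi, mul_one]

/-- The projector onto the strings that vanish from position `d` on. -/
def vanishProj (d N : ℕ) : QMat N :=
  Matrix.diagonal fun x => if ∀ i : Fin N, d ≤ i.1 → x i = false then 1 else 0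

theorem vanishProj_mul_embedMatrix {d N : ℕ} (h : d ≤ N) (M : QMat d) :
    vanishProj d N * embedMatrix N (Fin.castLE h) M =
      embedMatrix N (Fin.castLE h) M * vanishProj d N := by
  ext x y
  rw [vanishProj, Matrix.mul_diagonal, Matrix.diagonal_mul]
  simp only [embedMatrix, castLE_ne_iff]
  by_cases hxy : ∀ i : Fin N, d ≤ i.1 → x i = y i
  · have : (∀ i : Fin N, d ≤ i.1 → x i = false) ↔ ∀ i : Fin N, d ≤ i.1 → y i = false :=
      forall₂_congr fun i hi => by rw [hxy i hi]
    simp only [this, if_pos hxy, mul_comm]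
  · simp [if_neg hxy]

/-! ### Permutation gates -/

/-- Adding `f` to bit `t`. -/
def xorAt {N : ℕ} (t : Fin N) (f : Bits N → Bool) (y : Bits N) : Bits N :=
  Function.update y t (xor (y t) (f y))

/-- If `f` does not read bit `t`, the map is its own inverse. -/
theorem xorAt_injective {N : ℕ} {t : Fin N} {f : Bits N → Bool}
    (hf : ∀ y b, f (Function.update y t b) = f y) : Function.Injective (xorAt t f) := by
  refine Function.LeftInverse.injective (g := xorAt t f) fun y => ?_
  simp [xorAt, hf]

theorem applyOn_cnotMatrix {N a b : ℕ} (h : ValidWires N [a, b]) :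
    applyOn N [a, b] cnotMatrix =
      basisMapMatrix (xorAt (h.wire 1) fun y => y (h.wire 0)) := by
  rw [applyOn_of_valid h, cnotMatrix_eq, embedMatrix_basisMapMatrix h.wire_injective]
  congr 1
  ext1 y
  rw [graft_eq_iff h.wire_injective]
  have h01 : h.wire 0 ≠ h.wire 1 := h.wire_injective.ne (by simp)
  constructor
  · ext j
    fin_cases j
    · exact Function.update_of_ne h01 _ _
    · exact Function.update_self ..
  · intro i hi
    exact (Function.update_of_ne (hi 1).symm _ _).symm

open Classical in
theorem applyOn_languageMatrix {N t : ℕ} {ws : List ℕ} (L : Set (List Bool))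
    (h : ValidWires N (t :: ws)) :
    applyOn N (t :: ws) (languageMatrix L ws.length) =
      basisMapMatrix (xorAt (h.wire 0) fun y =>
        decide (List.ofFn (fun j : Fin ws.length => y (h.wire j.succ)) ∈ L)) := by
  have he : languageMatrix L ws.length = basisMapMatrix fun y : Bits (ws.length + 1) =>
      Fin.cons (xor (y 0) (decide (List.ofFn (Fin.tail y) ∈ L))) (Fin.tail y) := by
    ext x y
    simp only [languageMatrix, basisMapMatrix]
  rw [applyOn_of_valid h, he]
  refine (embedMatrix_basisMapMatrix h.wire_injective _).trans ?_
  congr 1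
  ext1 y
  rw [graft_eq_iff h.wire_injective]
  constructor
  · ext j
    induction j using Fin.cases with
    | zero => exact Function.update_self ..
    | succ j => exact Function.update_of_ne (h.wire_injective.ne (Fin.succ_ne_zero j)) _ _
  · intro i hi
    exact (Function.update_of_ne (hi 0).symm _ _).symm

/-! ### Passing the output of a circuit to a language -/

namespace Circuit

variable {d s : ℕ}

/-- The circuit that runs `C`, asks a language oracle about the output, and outputs the answer. -/
def thenAsk (C : Circuit Gate d s) : Circuit LGate d 1 where
  -- With two extra wires, the answer wire `C.wires + 1` differs from wire 0 even if `C` has no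
  -- wires.
  width := C.wires + 2
  gates := (C.gates.filter fun g => ValidWires C.wires g.wireList).map LGate.base ++
    -- The output has to be on wire 0. The two CNOTs take bits (a, b) on wires 0 and `C.wires + 1`
    -- to (a, b ⊕ a) and then to (b, b ⊕ a).
    [.lang (C.wires + 1) (List.range s), .base (.cnot 0 (C.wires + 1)),
      .base (.cnot (C.wires + 1) 0)]

theorem wires_thenAsk (C : Circuit Gate d s) : C.thenAsk.wires = C.wires + 2 := by
  have := C.input_le_wires
  simp only [wires, thenAsk] at this ⊢
  omega

theorem sum_filter_cost_le (l : List Gate) (p : Gate → Bool) :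
    (((l.filter p).map LGate.base).map LGate.cost).sum ≤ (l.map Gate.cost).sum := by
  rw [List.map_map]
  exact (List.filter_sublist.map Gate.cost).sum_le_sum (by simp)

theorem size_thenAsk_le (C : Circuit Gate d s) :
    C.thenAsk.size LGate.cost ≤ 2 * C.size Gate.cost + 6 := by
  have h1 := sum_filter_cost_le C.gates fun g => ValidWires C.wires g.wireList
  have h2 := C.output_le_wires
  rw [size, wires_thenAsk, thenAsk, List.map_append, List.sum_append, size]
  simp only [List.map_cons, List.map_nil, List.sum_cons, List.sum_nil, LGate.cost, Gate.cost,
    List.length_range]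
  omega

/-- `embedMatrix` tensors with the identity on the new wires; the projector cuts this identity down
to |0…0⟩⟨0…0|. -/
theorem initialState_thenAsk (C : Circuit Gate d s) (ρ : QMat d) (h : C.wires ≤ C.thenAsk.wires) :
    C.thenAsk.initialState ρ =
      embedMatrix _ (Fin.castLE h) (C.initialState ρ) * vanishProj C.wires C.thenAsk.wires := by
  ext x y
  rw [vanishProj, Matrix.mul_diagonal]
  simp only [initialState, embedMatrix, castLE_ne_iff, ← ite_and, mul_ite, mul_one, mul_zero]
  refine if_congr ?_ rfl rfl
  have hd := C.input_le_wires
  constructor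
  · intro H
    exact ⟨fun i hi => (H i (hd.trans hi)).2, fun i hi => by
      rw [(H i (hd.trans hi)).1, (H i (hd.trans hi)).2], fun i hi => H (Fin.castLE h i) hi⟩
  · rintro ⟨h1, h2, h3⟩ i hi
    rcases lt_or_ge i.1 C.wires with hw | hw
    · exact h3 ⟨i.1, hw⟩ hi
    · exact ⟨(h2 i hw).trans (h1 i hw), h1 i hw⟩

open Classical in
/-- The circuit answers `1` when the output of `C` is in the language. -/
theorem measureProb_thenAsk (C : Circuit Gate d s) (U : QuantumOracle) (L : Set (List Bool))
    (ρ : QMat d) :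
    measureProb (C.thenAsk.run (LGate.matrix U L) ρ) (firstBitOne 1) =
      measureProb (C.run (Gate.matrix U) ρ) {y | List.ofFn y ∈ L} := by
  have hW := C.wires_thenAsk
  have hs := C.output_le_wires
  have hle : C.wires ≤ C.thenAsk.wires := by omega
  have hinj := Fin.castLE_injective hle
  have vl : ValidWires C.thenAsk.wires ((C.wires + 1) :: List.range s) := by
    refine ⟨List.nodup_cons.2 ⟨by simp; omega, List.nodup_range⟩, ?_⟩
    simp only [List.mem_cons, List.mem_range]
    omega
  have v1 : ValidWires C.thenAsk.wires [0, C.wires + 1] := by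
    refine ⟨by simp, ?_⟩
    simp only [List.mem_cons, List.not_mem_nil, or_false]
    omega
  have v2 : ValidWires C.thenAsk.wires [C.wires + 1, 0] := by
    refine ⟨by simp, ?_⟩
    simp only [List.mem_cons, List.not_mem_nil, or_false]
    omega
  set a : Fin C.thenAsk.wires := ⟨0, by omega⟩ with ha
  set b : Fin C.thenAsk.wires := ⟨C.wires + 1, by omega⟩ with hb
  have hab : a ≠ b := by simp [a, b]
  let f : Bits C.thenAsk.wires → Bool := fun y =>
    decide (List.ofFn (fun j : Fin (List.range s).length => y (vl.wire j.succ)) ∈ L)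
  have hf : ∀ y c, f (Function.update y b c) = f y := by
    intro y c
    have : ∀ j : Fin (List.range s).length, vl.wire j.succ ≠ b := fun j =>
      vl.wire_injective.ne (Fin.succ_ne_zero j)
    simp only [f, Function.update_of_ne (this _)]
  -- The query and the two CNOTs together permute the computational basis, so they merely relabel
  -- measurement outcomes.
  let g := xorAt a (fun y => y b) ∘ xorAt b (fun y => y a) ∘ xorAt b f
  have hg : Function.Injective g := by
    refine (xorAt_injective ?_).comp ((xorAt_injective ?_).comp (xorAt_injective hf))
    · intro y c
      exact Function.update_of_ne hab.symm _ _
    · intro y c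
      exact Function.update_of_ne hab _ _
  have hop : C.thenAsk.operator (LGate.matrix U L) =
      basisMapMatrix g * embedMatrix _ (Fin.castLE hle) (C.operator (Gate.matrix U)) := by
    have e1 : (LGate.lang (C.wires + 1) (List.range s)).matrix U L C.thenAsk.wires =
        basisMapMatrix (xorAt b f) := applyOn_languageMatrix L vl
    have e2 : (LGate.base (.cnot 0 (C.wires + 1))).matrix U L C.thenAsk.wires =
        basisMapMatrix (xorAt b fun y => y a) := applyOn_cnotMatrix v1
    have e3 : (LGate.base (.cnot (C.wires + 1) 0)).matrix U L C.thenAsk.wires =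
        basisMapMatrix (xorAt a fun y => y b) := applyOn_cnotMatrix v2
    have e0 := foldl_operator_wider U L hle C.gates
    have hgates : C.thenAsk.gates =
      (C.gates.filter fun g => ValidWires C.wires g.wireList).map LGate.base ++
      [.lang (C.wires + 1) (List.range s), .base (.cnot 0 (C.wires + 1)),
        .base (.cnot (C.wires + 1) 0)] := rfl
    rw [operator, hgates, List.foldl_append, e0]
    simp only [List.foldl_cons, List.foldl_nil, e1, e2, e3]
    simp only [← mul_assoc, basisMapMatrix_mul]
    rfl
  have hfin : C.thenAsk.finalState (LGate.matrix U L) ρ = basisMapMatrix g *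
      (embedMatrix _ (Fin.castLE hle) (C.finalState (Gate.matrix U) ρ) *
        vanishProj C.wires C.thenAsk.wires) * (basisMapMatrix g).conjTranspose := by
    rw [finalState, hop, C.initialState_thenAsk ρ hle, Matrix.conjTranspose_mul, finalState,
      embedMatrix_mul hinj, embedMatrix_mul hinj, embedMatrix_conjTranspose]
    -- The projector concerns only the new wires, so it moves past the adjoint of the circuit of
    -- `C`.
    have hc := vanishProj_mul_embedMatrix hle (C.operator (Gate.matrix U)).conjTranspose
    rw [embedMatrix_conjTranspose] at hc
    simp only [mul_assoc]
    rw [← mul_assoc (vanishProj _ _), hc]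
    simp only [mul_assoc]
  have hga : ∀ w : Bits C.wires, g (graft (Fin.castLE hle) w fun _ => false) a =
      decide (List.ofFn (w ∘ Fin.castLE hs) ∈ L) := by
    intro w
    set y : Bits C.thenAsk.wires := graft (Fin.castLE hle) w fun _ => false with hy
    have hyb : y b = false := graft_apply_of_forall_ne ((castLE_ne_iff hle b).2 (by simp [b]))
    have hyf : f y = decide (List.ofFn (w ∘ Fin.castLE hs) ∈ L) := by
      have : List.ofFn (fun j : Fin (List.range s).length => y (vl.wire j.succ)) =
          List.ofFn (w ∘ Fin.castLE hs) := by
        refine List.ext_getElem (by simp) fun j h1 h2 => ?_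
        have hj : j < C.wires := by simp at h2; omega
        have hv : ∀ hj', vl.wire (Fin.succ ⟨j, hj'⟩) = Fin.castLE hle ⟨j, hj⟩ := by
          intro hj'
          ext
          simp [ValidWires.wire]
        simp only [List.getElem_ofFn, hv]
        exact congrFun (graft_comp hinj w _) ⟨j, hj⟩
      simp only [f, this]
    cases h : y a <;> simp [g, xorAt, hyb, hab, hyf, h]
  rw [measureProb_run, measureProb_run, hfin, sum_diag_basisMapMatrix hg]
  have hmem : ∀ x : Bits C.thenAsk.wires,
      (g x ∘ Fin.castLE C.thenAsk.output_le_wires ∈ firstBitOne 1) ↔ g x a = true := by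
    intro x
    exact ⟨fun ⟨_, h⟩ => h, fun h => ⟨one_pos, h⟩⟩
  calc _ = ∑ x : Bits C.thenAsk.wires, if ∀ i : Fin _, C.wires ≤ i.1 → x i = false then
        (if g x a = true then (C.finalState (Gate.matrix U) ρ (x ∘ Fin.castLE hle)
          (x ∘ Fin.castLE hle)).re else 0) else 0 := by
        refine Finset.sum_congr rfl fun x _ => ?_
        simp only [hmem]
        rw [vanishProj, Matrix.mul_diagonal]
        simp only [embedMatrix, implies_true, if_true, mul_ite, mul_one, mul_zero]
        split_ifs <;> simp
    _ = _ := by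
        rw [sum_vanish_from hle (fun x => if g x a = true then
          (C.finalState (Gate.matrix U) ρ (x ∘ Fin.castLE hle) (x ∘ Fin.castLE hle)).re else 0)]
        simp only [hga, graft_comp hinj, decide_eq_true_eq, Set.mem_ofPred_eq]

end Circuit

/-! ### The acceptance problem of quantum circuits with a classical witness -/

/-- Does the described circuit accept some classical input? -/
def witnessProblem (U : QuantumOracle) : PromiseProblem where
  yes := {x | ∃ w, 2 / 3 ≤ acceptProb U (decodeCircuit x).2.2 w}
  no := {x | ∀ w, acceptProb U (decodeCircuit x).2.2 w ≤ 1 / 3}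

/-- An instance is already the description of its own verifier, so the identity serves as the
verifier's Turing machine. -/
theorem witnessProblem_inQCMA (U : QuantumOracle) : InQCMA U (witnessProblem U) :=
  ⟨id, polyTime_id, ⟨Polynomial.X, fun x => by simpa using (decodeCircuit_le x).1⟩,
    fun _ hx => hx, fun _ hx => hx⟩

theorem half_le_binaryFraction {o : ℕ} {y : Bits o} (hy : y ∈ firstBitOne o) :
    1 / 2 ≤ binaryFraction y := by
  obtain ⟨ho, hy⟩ := hy
  refine le_trans ?_ (Finset.single_le_sum (f := fun j : Fin o =>
    if y j then (1 / 2 : ℝ) ^ (j.1 + 1) else 0) (fun j _ => ?_) (Finset.mem_univ ⟨0, ho⟩))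
  · simp [hy]
  · positivity

theorem binaryFraction_le_half {o : ℕ} {y : Bits o} (hy : y ∉ firstBitOne o) :
    binaryFraction y ≤ 1 / 2 := by
  cases o with
  | zero => simp [binaryFraction]
  | succ o =>
    have h0 : y 0 = false := by
      simpa using fun h => hy ⟨o.succ_pos, h⟩
    have hsum : ∀ o : ℕ, ∑ j ∈ Finset.range o, (1 / 2 : ℝ) ^ (j + 1 + 1) =
        1 / 2 - (1 / 2) ^ (o + 1) := by
      intro o
      induction o with
      | zero => simp
      | succ o ih => rw [Finset.sum_range_succ, ih]; ring
    rw [binaryFraction, Fin.sum_univ_succ, h0]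
    calc _ ≤ ∑ j : Fin o, (1 / 2 : ℝ) ^ (j.1 + 1 + 1) := by
          simp only [Bool.false_eq_true, if_false, zero_add, Fin.val_succ]
          refine Finset.sum_le_sum fun j _ => ?_
          split_ifs
          · exact le_rfl
          · positivity
      _ = 1 / 2 - (1 / 2) ^ (o + 1) := by
          rw [Fin.sum_univ_eq_sum_range fun j => (1 / 2 : ℝ) ^ (j + 1 + 1), hsum]
      _ ≤ 1 / 2 := by
          have : (0 : ℝ) ≤ (1 / 2) ^ (o + 1) := by positivity
          linarith

section Estimator

variable {U : QuantumOracle} {m n : ℕ} {φ : Bits m → PureState n} {y : List Bool}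

/-- The key itself is the witness: its overlap is 1, so a good estimate is at least 99/100 and has
first bit 1. -/
theorem DescribesEstimator.mem_yes {k : Bits m}
    (h : DescribesEstimator U φ (φ k).proj (1 / (100 : ℕ)) y) : y ∈ (witnessProblem U).yes := by
  obtain ⟨o, C, hy, hC⟩ := h
  change ∃ w, 2 / 3 ≤ acceptProb U (decodeCircuit y).2.2 w
  rw [hy]
  refine ⟨k, (hC k).trans ?_⟩
  refine Circuit.measureProb_run_mono (Gate.matrix_mem_unitary U) C (isMixedState_ketbra k) ?_
  intro z hz
  by_contra hz'
  have h1 := binaryFraction_le_half hz'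
  have h2 : ((φ k).proj * (φ k).proj).trace.re = 1 := by
    rw [PureState.trace_proj_mul_proj, inner_self_eq_norm_sq_to_K]
    simp
  rw [Set.mem_ofPred_eq, h2, abs_le] at hz
  norm_num at hz
  linarith

/-- A good estimate is below 12/25 + 1/100 = 49/100 and so has first bit 0; for each key, only the
estimator's failure probability of at most 1/3 remains. -/
theorem DescribesEstimator.mem_no {ψ : PureState n}
    (hψ : ∀ k, ‖inner ℂ (φ k).1 ψ.1‖ ^ 2 < 12 / 25)
    (h : DescribesEstimator U φ ψ.proj (1 / (100 : ℕ)) y) : y ∈ (witnessProblem U).no := by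
  obtain ⟨o, C, hy, hC⟩ := h
  change ∀ w, acceptProb U (decodeCircuit y).2.2 w ≤ 1 / 3
  rw [hy]
  intro k
  have hu := Gate.matrix_mem_unitary U
  have h1 := Circuit.measureProb_run_add_compl hu C (isMixedState_ketbra k) (firstBitOne o)
  have h2 := (hC k).trans (Circuit.measureProb_run_mono hu C (isMixedState_ketbra k)
    (S' := (firstBitOne o)ᶜ) ?_)
  · unfold acceptProb
    linarith
  · intro z hz hz'
    have h1 := half_le_binaryFraction hz'
    have h2 := hψ k
    rw [Set.mem_ofPred_eq, PureState.trace_proj_mul_proj, abs_le] at hz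
    norm_num at hz
    linarith

end Estimator

/-! ### Breaking pseudorandom states -/

/-- A procedure for estimating overlaps, followed by a query to the acceptance problem, tells the
states of a family from states that have a small overlap with all of them. -/
theorem exists_distinguisher {U : QuantumOracle} {m n T s : ℕ} {φ : Bits m → PureState n}
    (V : Circuit Gate (T * n) s)
    (hV : ∀ ρ : QMat n, IsMixedState ρ → 2 / 3 ≤ measureProb (V.run (Gate.matrix U)
      (tensorPower T ρ)) {y | DescribesEstimator U φ ρ (1 / (100 : ℕ)) (List.ofFn y)})
    {L : Set (List Bool)} (hyes : (witnessProblem U).yes ⊆ L)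
    (hno : Disjoint L (witnessProblem U).no) :
    (∀ k, 2 / 3 ≤ measureProb (V.thenAsk.run (LGate.matrix U L)
      (tensorPower T (φ k).proj)) (firstBitOne 1)) ∧
    ∀ ψ : PureState n,
      0 ≤ measureProb (V.thenAsk.run (LGate.matrix U L) (tensorPower T ψ.proj)) (firstBitOne 1) ∧
      measureProb (V.thenAsk.run (LGate.matrix U L) (tensorPower T ψ.proj)) (firstBitOne 1) ≤ 1 ∧
      ((∀ k, ‖inner ℂ (φ k).1 ψ.1‖ ^ 2 < 12 / 25) →
        measureProb (V.thenAsk.run (LGate.matrix U L) (tensorPower T ψ.proj))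
          (firstBitOne 1) ≤ 1 / 3) := by
  have hu := Gate.matrix_mem_unitary U
  simp only [Circuit.measureProb_thenAsk]
  refine ⟨fun k => ?_, fun ψ => ?_⟩
  · exact (hV _ (φ k).isMixedState_proj).trans (Circuit.measureProb_run_mono hu V
      ((φ k).isMixedState_tensorPower T) fun y hy => hyes (DescribesEstimator.mem_yes hy))
  · have hψ := ψ.isMixedState_tensorPower T
    have h1 := Circuit.measureProb_run_add_compl hu V hψ {y | List.ofFn y ∈ L}
    refine ⟨Circuit.measureProb_run_nonneg hu V hψ _, ?_, fun h => ?_⟩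
    · linarith [Circuit.measureProb_run_nonneg hu V hψ {y | List.ofFn y ∈ L}ᶜ]
    -- Every successful tomography output is a no-instance, hence outside `L`; what `L` contains off
    -- the promise matters only when tomography fails.
    · have h2 := (hV _ ψ.isMixedState_proj).trans (Circuit.measureProb_run_mono hu V hψ
        (S' := {y | List.ofFn y ∈ L}ᶜ) fun y hy hy' =>
          Set.disjoint_left.1 hno hy' (DescribesEstimator.mem_no h hy))
      linarith

/-- The expectation over Haar-random states of a function that is small on all states with a small
overlap with each member of a keyed family. -/
theorem integral_haarState_le {m n : ℕ} (φ : Bits m → PureState n) {F : PureState n → ℝ}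
    (h0 : ∀ ψ, 0 ≤ F ψ) (h1 : ∀ ψ, F ψ ≤ 1)
    (h : ∀ ψ, (∀ k, ‖inner ℂ (φ k).1 ψ.1‖ ^ 2 < 12 / 25) → F ψ ≤ 1 / 3) :
    ∫ ψ, F ψ ∂(haarState n) ≤ 1 / 3 + 8 * (2 ^ m * Real.exp (-((2 : ℝ) ^ n / 3))) := by
  set B : Set (PureState n) := ⋃ k, {ψ | 12 / 25 ≤ ‖inner ℂ (φ k).1 ψ.1‖ ^ 2} with hB
  have hBm : MeasurableSet B := by
    refine MeasurableSet.iUnion fun k => IsClosed.measurableSet ?_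
    exact isClosed_le (by fun_prop) (by fun_prop)
  have hBle : (haarState n).real B ≤ 8 * (2 ^ m * Real.exp (-((2 : ℝ) ^ n / 3))) := by
    calc _ ≤ ∑ k, (haarState n).real {ψ | 12 / 25 ≤ ‖inner ℂ (φ k).1 ψ.1‖ ^ 2} :=
          measureReal_iUnion_fintype_le _
      _ ≤ ∑ _k : Bits m, 8 * Real.exp (-((2 : ℝ) ^ n / 3)) :=
          Finset.sum_le_sum fun k _ => haarState_overlap_le (φ k)
      _ = _ := by
          simp
          ring
  have hint : Integrable (B.indicator fun _ => (1 : ℝ)) (haarState n) :=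
    (integrable_const 1).indicator hBm
  calc _ ≤ ∫ ψ, (1 / 3 + B.indicator (fun _ => (1 : ℝ)) ψ) ∂(haarState n) := by
        -- This comparison asks only that `F` be nonnegative, so no measurability of `F` is
        -- required.
        refine integral_mono_of_nonneg (.of_forall h0) ((integrable_const _).add hint)
          (.of_forall fun ψ => ?_)
        by_cases hψ : ψ ∈ B
        · simp only [Set.indicator_of_mem hψ]
          linarith [h1 ψ]
        · simp only [Set.indicator_of_notMem hψ, add_zero]
          refine h ψ fun k => ?_
          by_contra hk
          exact hψ (Set.mem_iUnion.2 ⟨k, not_lt.1 hk⟩)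
    _ = 1 / 3 + (haarState n).real B := by
        rw [integral_add (integrable_const _) hint, integral_indicator_const _ hBm]
        simp
    _ ≤ _ := by gcongr

theorem theorem1p3 (U : QuantumOracle) (hST : HyperefficientShadowTomography U)
    (E : KeyedStates) (hE : E.IsPseudorandom U)
    (hn : Negligible (fun κ => (2 : ℝ) ^ κ * Real.exp (-((2 : ℝ) ^ E.n κ / 3)))) :
    E.BrokenWithQCMA U := by
  obtain ⟨⟨fg, hfg, hG⟩, -⟩ := hE
  obtain ⟨f, hf, hST⟩ := hST
  choose G hG1 hG2 using hG
  choose T s V hV hVρ using fun κ =>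
    hST (E.n κ) κ 100 _ (G κ) (E.state κ) (by norm_num) (hG1 κ) (hG2 κ)
  set x : ℕ → List Bool := fun κ => unaryCode (E.n κ) ++ unaryCode κ ++ unaryCode 100 ++
    fg (List.replicate κ true) with hx
  have hfgp : PolyBounded fun κ => (fg (List.replicate κ true)).length :=
    hfg.polyBounded (by simpa using polyBounded_id)
  have hnp : PolyBounded E.n := hfgp.mono fun κ => by
    have := (decodeCircuit_le (fg (List.replicate κ true))).2.1
    rwa [hG1] at this
  have hxp : PolyBounded fun κ => (f (x κ)).length := by
    refine hf.polyBounded (PolyBounded.mono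
      (((hnp.add polyBounded_id).add hfgp).add (polyBounded_const 103)) fun κ => ?_)
    simp [hx, unaryCode]
    omega
  have hVx : ∀ κ, T κ * E.n κ ≤ (f (x κ)).length ∧
      (V κ).size Gate.cost ≤ (f (x κ)).length := by
    intro κ
    obtain ⟨h1, -, h3⟩ := decodeCircuit_le (f (x κ))
    rw [hV κ] at h1 h3
    exact ⟨h1, h3⟩
  -- The description of `V κ` bounds only the product `T κ * E.n κ`, which says nothing about `T κ`
  -- if `E.n κ = 0`; a trivial adversary is used there. The adversary is fixed before `L`, as the
  -- conclusion requires.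
  have hA : ∀ κ, ∃ (T : ℕ) (A : Circuit LGate (T * E.n κ) 1), T ≤ (f (x κ)).length ∧
      A.size LGate.cost ≤ (f (x κ)).length * 2 + 6 ∧
      (E.n κ ≠ 0 → ∀ L, (witnessProblem U).yes ⊆ L → Disjoint L (witnessProblem U).no →
        2 / 3 - (1 / 3 + 8 * (2 ^ κ * Real.exp (-((2 : ℝ) ^ E.n κ / 3)))) ≤
          E.advantage (LGate.matrix U L) κ T A) := by
    intro κ
    by_cases h0 : E.n κ = 0
    · exact ⟨0, ⟨0, []⟩, Nat.zero_le _, by simp [Circuit.size, Circuit.wires],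
        fun h => absurd h0 h⟩
    · refine ⟨T κ, (V κ).thenAsk, ?_, ?_, fun _ L hyes hno => ?_⟩
      · exact (Nat.le_mul_of_pos_right _ (Nat.pos_of_ne_zero h0)).trans (hVx κ).1
      · have := (V κ).size_thenAsk_le
        have := (hVx κ).2
        omega
      · obtain ⟨h1, h2⟩ := exists_distinguisher (V κ) (hVρ κ) hyes hno
        refine le_trans (sub_le_sub ?_ (integral_haarState_le (E.state κ) (fun ψ => (h2 ψ).1)
          (fun ψ => (h2 ψ).2.1) (fun ψ => (h2 ψ).2.2))) (le_abs_self _)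
        rw [le_inv_mul_iff₀ (by positivity)]
        calc (2 : ℝ) ^ κ * (2 / 3) = ∑ _k : Bits κ, (2 / 3 : ℝ) := by simp
          _ ≤ _ := Finset.sum_le_sum fun k _ => h1 k
  choose T' A hT' hA' hadv using hA
  refine ⟨witnessProblem U, witnessProblem_inQCMA U, T', A, hxp.mono hT',
    ((hxp.mul_const 2).add (polyBounded_const 6)).mono hA', 1 / 6, by norm_num, ?_⟩
  intro L hyes hno
  -- Superpolynomial decay at exponent 0 is convergence to 0.
  have hlim := hn 0
  simp only [pow_zero, one_mul] at hlim
  -- The threshold makes the Haar error at most 8/48 = 1/6, half of the gap 2/3 - 1/3.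
  filter_upwards [hlim.eventually_le_const (show (0 : ℝ) < 1 / 48 by norm_num)] with κ hκ
  refine le_trans ?_ (hadv κ ?_ L hyes hno)
  · linarith
  -- If `E.n κ = 0`, the error term is 2^κ e^{-1/3} ≥ 2/3, above the threshold.
  · intro h0
    rw [h0] at hκ
    have h1 : (1 : ℝ) ≤ 2 ^ κ := one_le_pow₀ (by norm_num)
    have h2 := Real.add_one_le_exp (-((2 : ℝ) ^ 0 / 3))
    norm_num at h2 hκ
    nlinarith
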